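/- A (finite, integer-valued) scoring game is an integer or a pair $\{G^L\mid G^R\}$ of finite nonempty families of scoring games (its left and right options). Integers are even-tempered; $\{G^L\mid G^R\}$ is even-tempered (odd-tempered) if all its options are odd-tempered (even-tempered); a game is well-tempered if it is even- or odd-tempered. Let $L(n)=R(n)=n$ for integers $n$ and otherwise $L(G)=\max_{G^L}R(G^L)$, $R(G)=\min_{G^R}L(G^R)$. The sum $G+H$ is the usual one for two integers and $\{G^L+H,G+H^L\mid G^R+H,G+H^R\}$ otherwise. For well-tempered games write $G\lesssim H$ if $L(G+X)\le L(H+X)$ and $R(G+X)\le R(H+X)$ for all well-tempered $X$, and $G\approx H$ if both equalities hold for all such $X$. For $t\in\mathbb Z$ let $\int^t n=n$ for integers $n$ and $\int^t G=\{t+\int^t G^L\mid -t+\int^t G^R\}$ otherwise. For $i=0$ (resp. $i=1$) let $\operatorname{gap}_i(G)$ be the supremum of $R(H)-L(H)$ over the even-tempered (resp. odd-tempered) subgames $H$ of $G$ ($-\infty$ if there are none). Let $\mathcal I$ be the class of well-tempered games with $\operatorname{gap}_0(G)=0$ (these are, up to $\approx$, exactly the invertible games), let $\mathcal F_n=\{G\in\mathcal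 I:\operatorname{gap}_1(G)\le 2n\}$ and $\mathcal J=\mathcal F_1$. Let $\mathbf I^0$ be the set of $\approx$-classes of even-tempered games in $\mathcal I$, with the addition and the order induced by $+$ and $\lesssim$. Let $\mathbf{Pg}$ be the partially ordered abelian group of short normal-play partizan games modulo the usual equality, and let $\psi$ be the map from scoring games to $\mathbf{Pg}$ with $\psi(n)=n$ for integers $n$ and $\psi(\{G^L\mid G^R\})=\{\psi(G^L)\mid\psi(G^R)\}$. Put $*=\{0\mid 0\}$ and $1*=1+*$, and let the overheating operation $\int_1^{1*}:\mathbf{Pg}\to\mathbf{Pg}$ be the order-preserving homomorphism induced by the recursion $\int_1^{1*}G=\{\int_1^{1*}G^L+1*\mid\int_1^{1*}G^R-1*\}$ on partizan games $G$. **Theorem.** (1) For every $G\in\mathcal J$, \[\psi\Big(\int^1 G\Big)=\int_1^{1*}\psi(G)\ \text{ if $G$ is even-tempered},\qquad \psi\Big(\int^1 G\Big)=*+\int_1^{1*}\psi(G)\ \text{ if $G$ is odd-tempered}.\] (2) As a partially ordered abelian group, $\mathbf I^0$ is isomorphic to the direct limit of \[\mathbf{Pg}\xrightarrow{\int_1^{1*}}\mathbf{Pg}\xrightarrow{\int_1^{1*}}\mathbf{Pg}\xrightarrow{\int_1^{1*}}\cdots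 .\] More precisely, there is an isomorphism which, for every $n\ge 0$ and every even-tempered $G\in\mathcal F_{n+1}$, sends the class of $G$ to the image in the direct limit of the element $\psi(\int^n G)$ of the $n$-th copy of $\mathbf{Pg}$ (copies numbered from $0$). -/

import Mathlib

noncomputable section

/-! ### Short normal-play partizan games -/

/-- Forms of short (finite, loop-free) partizan games `{L | R}`: the left and the right options
form finite families. -/
inductive PartizanGame : Type 1
  | mk (α β : Type) [Finite α] [Finite β] (L : α → PartizanGame) (R : β → PartizanGame) :
      PartizanGame

namespace PartizanGame

/-- `l` is a left option of the game. -/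
def IsLeft (l : PartizanGame) : PartizanGame → Prop
  | mk _ _ L _ => ∃ i, L i = l

/-- `r` is a right option of the game. -/
def IsRight (r : PartizanGame) : PartizanGame → Prop
  | mk _ _ _ R => ∃ j, R j = r

mutual

/-- `Le x y`: the relation `x ≤ y` on partizan games: no left option of `x` is `≥ y` and no right
option of `y` is `≤ x` (with the negations spelled out by means of `Lf`). -/
inductive Le : PartizanGame → PartizanGame → Prop
  | intro {x y : PartizanGame} (hl : ∀ l, IsLeft l x → Lf l y) (hr : ∀ r, IsRight r y → Lf x r) :
      Le x y

/-- `Lf x y`: `x` is less than or fuzzy to `y`. -/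
inductive Lf : PartizanGame → PartizanGame → Prop
  | left {x y l : PartizanGame} (hl : IsLeft l y) (h : Le x l) : Lf x y
  | right {x y r : PartizanGame} (hr : IsRight r x) (h : Le r y) : Lf x y

end

/-- The game `0 = { | }`. -/
def zero : PartizanGame := mk Empty Empty Empty.elim Empty.elim

/-- The negative `-G = {-G^R | -G^L}`. -/
def neg : PartizanGame → PartizanGame
  | mk α β L R => mk β α (fun j => neg (R j)) (fun i => neg (L i))

/-- The disjunctive sum `G + H = {G^L + H, G + H^L | G^R + H, G + H^R}`. -/
def add (G : PartizanGame) : PartizanGame → PartizanGame :=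
  PartizanGame.rec (motive := fun _ => PartizanGame → PartizanGame)
    (fun α β _ _ _ _ ihL ihR H =>
      PartizanGame.rec (motive := fun _ => PartizanGame)
        (fun α' β' _ _ L' R' ihL' ihR' =>
          mk (α ⊕ α') (β ⊕ β')
            (Sum.elim (fun i => ihL i (mk α' β' L' R')) ihL')
            (Sum.elim (fun j => ihR j (mk α' β' L' R')) ihR')) H) G

theorem add_mk (α β : Type) [Finite α] [Finite β] (L : α → PartizanGame) (R : β → PartizanGame)
    (α' β' : Type) [Finite α'] [Finite β'] (L' : α' → PartizanGame) (R' : β' → PartizanGame) :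
    add (mk α β L R) (mk α' β' L' R') =
      mk (α ⊕ α') (β ⊕ β')
        (Sum.elim (fun i => add (L i) (mk α' β' L' R')) (fun i => add (mk α β L R) (L' i)))
        (Sum.elim (fun j => add (R j) (mk α' β' L' R')) (fun j => add (mk α β L R) (R' j))) :=
  rfl

/-- The natural number `n + 1 = {n | }`. -/
def ofNat : ℕ → PartizanGame
  | 0 => zero
  | n + 1 => mk Unit Empty (fun _ => ofNat n) Empty.elim

/-- The integers as partizan games. -/
def ofInt : ℤ → PartizanGame
  | .ofNat n => ofNat n
  | .negSucc n => neg (ofNat (n + 1))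

/-- The game `* = {0 | 0}`. -/
def star : PartizanGame := mk Unit Unit (fun _ => zero) (fun _ => zero)

/-- The map `f_K(G) = {f_K(G^L) + K | f_K(G^R) - K}`. -/
def overheat (K : PartizanGame) : PartizanGame → PartizanGame
  | mk α β L R =>
      mk α β (fun i => add (overheat K (L i)) K) (fun j => add (overheat K (R j)) (neg K))

/-! Basic facts needed for the group structure on games modulo equivalence. -/

theorem opt_induction {P : PartizanGame → Prop}
    (h : ∀ x, (∀ l, IsLeft l x → P l) → (∀ r, IsRight r x → P r) → P x) (x : PartizanGame) :
    P x := by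
  induction x with
  | mk α β L R ihL ihR =>
    exact h _ (by rintro _ ⟨i, rfl⟩; exact ihL i) (by rintro _ ⟨j, rfl⟩; exact ihR j)

theorem le_iff {x y : PartizanGame} :
    Le x y ↔ (∀ l, IsLeft l x → Lf l y) ∧ (∀ r, IsRight r y → Lf x r) :=
  ⟨fun h => by cases h with | intro hl hr => exact ⟨hl, hr⟩, fun h => .intro h.1 h.2⟩

theorem lf_iff {x y : PartizanGame} :
    Lf x y ↔ (∃ l, IsLeft l y ∧ Le x l) ∨ (∃ r, IsRight r x ∧ Le r y) :=
  ⟨fun h => by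
    cases h with
    | left hl h => exact .inl ⟨_, hl, h⟩
    | right hr h => exact .inr ⟨_, hr, h⟩,
   fun h => by
    rcases h with ⟨l, hl, h⟩ | ⟨r, hr, h⟩
    · exact .left hl h
    · exact .right hr h⟩

theorem not_le_and_not_lf (x y : PartizanGame) :
    (¬ Le x y ↔ Lf y x) ∧ (¬ Lf x y ↔ Le y x) := by
  induction x using opt_induction generalizing y with
  | h x ihl ihr =>
    induction y using opt_induction with
    | h y jhl jhr =>
      constructor
      · rw [le_iff, lf_iff, not_and_or]
        push Not
        refine or_congr (exists_congr fun l => and_congr_right fun hl => (ihl l hl y).2)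
          (exists_congr fun r => and_congr_right fun hr => (jhr r hr).2)
      · rw [le_iff, lf_iff, not_or]
        push Not
        refine and_congr (forall_congr' fun l => forall_congr' fun hl => (jhl l hl).1)
          (forall_congr' fun r => forall_congr' fun hr => (ihr r hr y).1)

theorem not_le {x y : PartizanGame} : ¬ Le x y ↔ Lf y x := (not_le_and_not_lf x y).1

theorem le_refl (x : PartizanGame) : Le x x := by
  induction x using opt_induction with
  | h x ihl ihr =>
    exact .intro (fun l hl => .left hl (ihl l hl)) (fun r hr => .right hr (ihr r hr))

theorem le_trans_aux {x y z : PartizanGame}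
    (h₁ : ∀ l, IsLeft l x → Le y z → Le z l → Le y l)
    (h₂ : ∀ r, IsRight r z → Le r x → Le x y → Le r y)
    (hxy : Le x y) (hyz : Le y z) : Le x z := by
  refine .intro (fun l hl => not_le.1 fun h => ?_) (fun r hr => not_le.1 fun h => ?_)
  · exact not_le.2 ((le_iff.1 hxy).1 l hl) (h₁ l hl hyz h)
  · exact not_le.2 ((le_iff.1 hyz).2 r hr) (h₂ r hr h hxy)

theorem le_trans_cyclic (x y z : PartizanGame) :
    (Le x y → Le y z → Le x z) ∧ (Le y z → Le z x → Le y x) ∧ (Le z x → Le x y → Le z y) := by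
  induction x using opt_induction generalizing y z with
  | h x xl xr =>
    induction y using opt_induction generalizing z with
    | h y yl yr =>
      induction z using opt_induction with
      | h z zl zr =>
        exact ⟨le_trans_aux (fun l hl => (xl l hl y z).2.1) (fun r hr => (zr r hr).2.2),
          le_trans_aux (fun l hl => (yl l hl z).2.2) (fun r hr => (xr r hr y z).1),
          le_trans_aux (fun l hl => (zl l hl).1) (fun r hr => (yr r hr z).2.1)⟩

theorem le_trans {x y z : PartizanGame} : Le x y → Le y z → Le x z := (le_trans_cyclic x y z).1

theorem isLeft_add {z x y : PartizanGame} : IsLeft z (add x y) ↔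
    (∃ l, IsLeft l x ∧ z = add l y) ∨ (∃ l, IsLeft l y ∧ z = add x l) := by
  cases x; cases y
  rw [add_mk]
  simp only [IsLeft, Sum.exists, Sum.elim_inl, Sum.elim_inr, exists_exists_eq_and, eq_comm (a := z)]

theorem isRight_add {z x y : PartizanGame} : IsRight z (add x y) ↔
    (∃ r, IsRight r x ∧ z = add r y) ∨ (∃ r, IsRight r y ∧ z = add x r) := by
  cases x; cases y
  rw [add_mk]
  simp only [IsRight, Sum.exists, Sum.elim_inl, Sum.elim_inr, exists_exists_eq_and, eq_comm (a := z)]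

theorem isLeft_neg {z x : PartizanGame} : IsLeft z (neg x) ↔ ∃ r, IsRight r x ∧ z = neg r := by
  cases x
  simp only [neg, IsLeft, IsRight, exists_exists_eq_and, eq_comm (a := z)]

theorem isRight_neg {z x : PartizanGame} : IsRight z (neg x) ↔ ∃ l, IsLeft l x ∧ z = neg l := by
  cases x
  simp only [neg, IsLeft, IsRight, exists_exists_eq_and, eq_comm (a := z)]

theorem not_isLeft_zero (z : PartizanGame) : ¬ IsLeft z zero := by rintro ⟨⟨⟩, _⟩

theorem not_isRight_zero (z : PartizanGame) : ¬ IsRight z zero := by rintro ⟨⟨⟩, _⟩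

theorem isLeft_overheat {K z x : PartizanGame} :
    IsLeft z (overheat K x) ↔ ∃ l, IsLeft l x ∧ z = add (overheat K l) K := by
  cases x
  simp only [overheat, IsLeft, exists_exists_eq_and, eq_comm (a := z)]

theorem isRight_overheat {K z x : PartizanGame} :
    IsRight z (overheat K x) ↔ ∃ r, IsRight r x ∧ z = add (overheat K r) (neg K) := by
  cases x
  simp only [overheat, IsRight, exists_exists_eq_and, eq_comm (a := z)]

theorem Lf.add_left {x y z l : PartizanGame} (hl : IsLeft l y) (h : Le x (add l z)) :
    Lf x (add y z) := .left (isLeft_add.2 (.inl ⟨l, hl, rfl⟩)) h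

theorem Lf.add_right {x y z l : PartizanGame} (hl : IsLeft l z) (h : Le x (add y l)) :
    Lf x (add y z) := .left (isLeft_add.2 (.inr ⟨l, hl, rfl⟩)) h

theorem Lf.add_left' {x y z r : PartizanGame} (hr : IsRight r y) (h : Le (add r z) x) :
    Lf (add y z) x := .right (isRight_add.2 (.inl ⟨r, hr, rfl⟩)) h

theorem Lf.add_right' {x y z r : PartizanGame} (hr : IsRight r z) (h : Le (add y r) x) :
    Lf (add y z) x := .right (isRight_add.2 (.inr ⟨r, hr, rfl⟩)) h

theorem add_mono_aux (x y z : PartizanGame) :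
    (Le x y → Le (add x z) (add y z)) ∧ (Lf x y → Lf (add x z) (add y z)) := by
  induction x using opt_induction generalizing y z with
  | h x xl xr =>
    induction y using opt_induction generalizing z with
    | h y yl yr =>
      induction z using opt_induction with
      | h z zl zr =>
        constructor
        · intro h
          have h' := le_iff.1 h
          constructor
          · intro l hl
            rw [isLeft_add] at hl
            rcases hl with ⟨l, hl, rfl⟩ | ⟨l, hl, rfl⟩
            · exact (xl l hl y z).2 (h'.1 l hl)
            · exact .add_right hl ((zl l hl).1 h)
          · intro r hr
            rw [isRight_add] at hr
            rcases hr with ⟨r, hr, rfl⟩ | ⟨r, hr, rfl⟩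
            · exact (yr r hr z).2 (h'.2 r hr)
            · exact .add_right' hr ((zr r hr).1 h)
        · intro h
          rcases lf_iff.1 h with ⟨l, hl, h⟩ | ⟨r, hr, h⟩
          · exact .add_left hl ((yl l hl z).1 h)
          · exact .add_left' hr ((xr r hr y z).1 h)

theorem add_mono_right {x y : PartizanGame} (z : PartizanGame) (h : Le x y) :
    Le (add x z) (add y z) := (add_mono_aux x y z).1 h

theorem add_comm_le (x y : PartizanGame) : Le (add x y) (add y x) := by
  induction x using opt_induction generalizing y with
  | h x xl xr =>
    induction y using opt_induction with
    | h y yl yr =>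
      constructor
      · intro l hl
        rw [isLeft_add] at hl
        rcases hl with ⟨l, hl, rfl⟩ | ⟨l, hl, rfl⟩
        · exact .add_right hl (xl l hl y)
        · exact .add_left hl (yl l hl)
      · intro r hr
        rw [isRight_add] at hr
        rcases hr with ⟨r, hr, rfl⟩ | ⟨r, hr, rfl⟩
        · exact .add_right' hr (yr r hr)
        · exact .add_left' hr (xr r hr y)

theorem add_assoc_le (x y z : PartizanGame) :
    Le (add (add x y) z) (add x (add y z)) ∧ Le (add x (add y z)) (add (add x y) z) := by
  induction x using opt_induction generalizing y z with
  | h x xl xr =>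
    induction y using opt_induction generalizing z with
    | h y yl yr =>
      induction z using opt_induction with
      | h z zl zr =>
        refine ⟨.intro ?_ ?_, .intro ?_ ?_⟩
        · intro l hl
          rw [isLeft_add] at hl
          rcases hl with ⟨l, hl, rfl⟩ | ⟨l, hl, rfl⟩
          · rw [isLeft_add] at hl
            rcases hl with ⟨l, hl, rfl⟩ | ⟨l, hl, rfl⟩
            · exact .add_left hl (xl l hl y z).1
            · exact .add_right (isLeft_add.2 (.inl ⟨l, hl, rfl⟩)) (yl l hl z).1
          · exact .add_right (isLeft_add.2 (.inr ⟨l, hl, rfl⟩)) (zl l hl).1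
        · intro r hr
          rw [isRight_add] at hr
          rcases hr with ⟨r, hr, rfl⟩ | ⟨r, hr, rfl⟩
          · exact .add_left' (isRight_add.2 (.inl ⟨r, hr, rfl⟩)) (xr r hr y z).1
          · rw [isRight_add] at hr
            rcases hr with ⟨r, hr, rfl⟩ | ⟨r, hr, rfl⟩
            · exact .add_left' (isRight_add.2 (.inr ⟨r, hr, rfl⟩)) (yr r hr z).1
            · exact .add_right' hr (zr r hr).1
        · intro l hl
          rw [isLeft_add] at hl
          rcases hl with ⟨l, hl, rfl⟩ | ⟨l, hl, rfl⟩
          · exact .add_left (isLeft_add.2 (.inl ⟨l, hl, rfl⟩)) (xl l hl y z).2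
          · rw [isLeft_add] at hl
            rcases hl with ⟨l, hl, rfl⟩ | ⟨l, hl, rfl⟩
            · exact .add_left (isLeft_add.2 (.inr ⟨l, hl, rfl⟩)) (yl l hl z).2
            · exact .add_right hl (zl l hl).2
        · intro r hr
          rw [isRight_add] at hr
          rcases hr with ⟨r, hr, rfl⟩ | ⟨r, hr, rfl⟩
          · rw [isRight_add] at hr
            rcases hr with ⟨r, hr, rfl⟩ | ⟨r, hr, rfl⟩
            · exact .add_left' hr (xr r hr y z).2
            · exact .add_right' (isRight_add.2 (.inl ⟨r, hr, rfl⟩)) (yr r hr z).2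
          · exact .add_right' (isRight_add.2 (.inr ⟨r, hr, rfl⟩)) (zr r hr).2

theorem add_zero_le (x : PartizanGame) : Le (add x zero) x ∧ Le x (add x zero) := by
  induction x using opt_induction with
  | h x xl xr =>
    refine ⟨.intro ?_ ?_, .intro ?_ ?_⟩
    · intro l hl
      rw [isLeft_add] at hl
      rcases hl with ⟨l, hl, rfl⟩ | ⟨l, hl, rfl⟩
      · exact .left hl (xl l hl).1
      · exact (not_isLeft_zero _ hl).elim
    · intro r hr
      exact .add_left' hr (xr r hr).1
    · intro l hl
      exact .add_left hl (xl l hl).2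
    · intro r hr
      rw [isRight_add] at hr
      rcases hr with ⟨r, hr, rfl⟩ | ⟨r, hr, rfl⟩
      · exact .right hr (xr r hr).2
      · exact (not_isRight_zero _ hr).elim

theorem neg_le_neg_aux (x y : PartizanGame) :
    (Le x y → Le (neg y) (neg x)) ∧ (Lf x y → Lf (neg y) (neg x)) := by
  induction x using opt_induction generalizing y with
  | h x xl xr =>
    induction y using opt_induction with
    | h y yl yr =>
      constructor
      · intro h
        constructor
        · intro l hl
          rw [isLeft_neg] at hl
          obtain ⟨r, hr, rfl⟩ := hl
          exact (yr r hr).2 ((le_iff.1 h).2 r hr)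
        · intro r hr
          rw [isRight_neg] at hr
          obtain ⟨l, hl, rfl⟩ := hr
          exact (xl l hl y).2 ((le_iff.1 h).1 l hl)
      · intro h
        rcases lf_iff.1 h with ⟨l, hl, h⟩ | ⟨r, hr, h⟩
        · exact .right (isRight_neg.2 ⟨l, hl, rfl⟩) ((yl l hl).1 h)
        · exact .left (isLeft_neg.2 ⟨r, hr, rfl⟩) ((xr r hr y).1 h)

theorem add_neg_le (x : PartizanGame) : Le (add x (neg x)) zero ∧ Le zero (add x (neg x)) := by
  induction x using opt_induction with
  | h x xl xr =>
    refine ⟨.intro ?_ fun r hr => (not_isRight_zero _ hr).elim,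
      .intro (fun l hl => (not_isLeft_zero _ hl).elim) ?_⟩
    · intro l hl
      rw [isLeft_add] at hl
      rcases hl with ⟨l, hl, rfl⟩ | ⟨l, hl, rfl⟩
      · exact .add_right' (isRight_neg.2 ⟨l, hl, rfl⟩) (xl l hl).1
      · rw [isLeft_neg] at hl
        obtain ⟨r, hr, rfl⟩ := hl
        exact .add_left' hr (xr r hr).1
    · intro r hr
      rw [isRight_add] at hr
      rcases hr with ⟨r, hr, rfl⟩ | ⟨r, hr, rfl⟩
      · exact .add_right (isLeft_neg.2 ⟨r, hr, rfl⟩) (xr r hr).2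
      · rw [isRight_neg] at hr
        obtain ⟨l, hl, rfl⟩ := hr
        exact .add_left hl (xl l hl).2

/-- Equality of values (as opposed to identity of forms): `x ≤ y` and `y ≤ x`. -/
instance setoid : Setoid PartizanGame where
  r x y := Le x y ∧ Le y x
  iseqv := ⟨fun x => ⟨le_refl x, le_refl x⟩, fun h => ⟨h.2, h.1⟩,
    fun h h' => ⟨le_trans h.1 h'.1, le_trans h'.2 h.2⟩⟩

theorem add_mono {x x' y y' : PartizanGame} (hx : Le x x') (hy : Le y y') :
    Le (add x y) (add x' y') :=
  le_trans (add_mono_right y hx)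
    (le_trans (add_comm_le _ _) (le_trans (add_mono_right x' hy) (add_comm_le _ _)))

end PartizanGame

/-- The group `Pg` of short partizan games modulo equality of values. -/
def Pg : Type 1 := Quotient PartizanGame.setoid

namespace Pg

open PartizanGame

/-- The value of a partizan game. -/
def mk (x : PartizanGame) : Pg := Quotient.mk _ x

/-- The order on values induced by `≤` on partizan games. -/
instance : PartialOrder Pg where
  le := Quotient.lift₂ Le fun _ _ _ _ h h' =>
    propext ⟨fun k => le_trans h.2 (le_trans k h'.1), fun k => le_trans h.1 (le_trans k h'.2)⟩
  le_refl := by rintro ⟨x⟩; exact PartizanGame.le_refl x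
  le_trans := by rintro ⟨x⟩ ⟨y⟩ ⟨z⟩ h h'; exact PartizanGame.le_trans h h'
  le_antisymm := by rintro ⟨x⟩ ⟨y⟩ h h'; exact Quotient.sound ⟨h, h'⟩

instance : Zero Pg := ⟨mk zero⟩

instance : Neg Pg :=
  ⟨Quotient.map neg fun x y h => ⟨(neg_le_neg_aux y x).1 h.2, (neg_le_neg_aux x y).1 h.1⟩⟩

instance : Add Pg :=
  ⟨Quotient.map₂ add fun _ _ h _ _ h' => ⟨add_mono h.1 h'.1, add_mono h.2 h'.2⟩⟩

instance : AddCommGroup Pg where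
  add_assoc := by rintro ⟨x⟩ ⟨y⟩ ⟨z⟩; exact Quotient.sound (add_assoc_le x y z)
  zero_add := by
    rintro ⟨x⟩
    exact Quotient.sound ⟨le_trans (add_comm_le _ _) (add_zero_le x).1,
      le_trans (add_zero_le x).2 (add_comm_le _ _)⟩
  add_zero := by rintro ⟨x⟩; exact Quotient.sound (add_zero_le x)
  add_comm := by rintro ⟨x⟩ ⟨y⟩; exact Quotient.sound ⟨add_comm_le x y, add_comm_le y x⟩
  neg_add_cancel := by
    rintro ⟨x⟩
    exact Quotient.sound ⟨le_trans (add_comm_le _ _) (add_neg_le x).1,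
      le_trans (add_neg_le x).2 (add_comm_le _ _)⟩
  nsmul := nsmulRec
  zsmul := zsmulRec

instance : IsOrderedAddMonoid Pg where
  add_le_add_left := by rintro ⟨x⟩ ⟨y⟩ h ⟨z⟩; exact add_mono_right z h

theorem mk_le_mk {x y : PartizanGame} : mk x ≤ mk y ↔ Le x y := Iff.rfl

theorem mk_add (x y : PartizanGame) : mk (add x y) = mk x + mk y := rfl

theorem mk_neg (x : PartizanGame) : mk (neg x) = - mk x := rfl

theorem mk_overheat_add_le (K x y : PartizanGame) :
    mk (overheat K (add x y)) ≤ mk (overheat K x) + mk (overheat K y) ∧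
      mk (overheat K x) + mk (overheat K y) ≤ mk (overheat K (add x y)) := by
  induction x using opt_induction generalizing y with
  | h x xl xr =>
    induction y using opt_induction with
    | h y yl yr =>
      refine ⟨.intro ?_ ?_, .intro ?_ ?_⟩
      · intro l hl
        rw [isLeft_overheat] at hl
        obtain ⟨l, hl, rfl⟩ := hl
        rw [isLeft_add] at hl
        rcases hl with ⟨l, hl, rfl⟩ | ⟨l, hl, rfl⟩
        · refine .add_left (isLeft_overheat.2 ⟨l, hl, rfl⟩) (mk_le_mk.1 ?_)
          simp only [mk_add]
          rw [add_right_comm]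
          exact add_le_add_left (xl l hl y).1 _
        · refine .add_right (isLeft_overheat.2 ⟨l, hl, rfl⟩) (mk_le_mk.1 ?_)
          simp only [mk_add]
          rw [← add_assoc]
          exact add_le_add_left (yl l hl).1 _
      · intro r hr
        rw [isRight_add] at hr
        rcases hr with ⟨r, hr, rfl⟩ | ⟨r, hr, rfl⟩
        · rw [isRight_overheat] at hr
          obtain ⟨r, hr, rfl⟩ := hr
          refine .right (isRight_overheat.2 ⟨_, isRight_add.2 (.inl ⟨r, hr, rfl⟩), rfl⟩)
            (mk_le_mk.1 ?_)
          simp only [mk_add]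
          rw [add_right_comm]
          exact add_le_add_left (xr r hr y).1 _
        · rw [isRight_overheat] at hr
          obtain ⟨r, hr, rfl⟩ := hr
          refine .right (isRight_overheat.2 ⟨_, isRight_add.2 (.inr ⟨r, hr, rfl⟩), rfl⟩)
            (mk_le_mk.1 ?_)
          simp only [mk_add]
          rw [← add_assoc]
          exact add_le_add_left (yr r hr).1 _
      · intro l hl
        rw [isLeft_add] at hl
        rcases hl with ⟨l, hl, rfl⟩ | ⟨l, hl, rfl⟩
        · rw [isLeft_overheat] at hl
          obtain ⟨l, hl, rfl⟩ := hl
          refine .left (isLeft_overheat.2 ⟨_, isLeft_add.2 (.inl ⟨l, hl, rfl⟩), rfl⟩)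
            (mk_le_mk.1 ?_)
          simp only [mk_add]
          rw [add_right_comm]
          exact add_le_add_left (xl l hl y).2 _
        · rw [isLeft_overheat] at hl
          obtain ⟨l, hl, rfl⟩ := hl
          refine .left (isLeft_overheat.2 ⟨_, isLeft_add.2 (.inr ⟨l, hl, rfl⟩), rfl⟩)
            (mk_le_mk.1 ?_)
          simp only [mk_add]
          rw [← add_assoc]
          exact add_le_add_left (yl l hl).2 _
      · intro r hr
        rw [isRight_overheat] at hr
        obtain ⟨r, hr, rfl⟩ := hr
        rw [isRight_add] at hr
        rcases hr with ⟨r, hr, rfl⟩ | ⟨r, hr, rfl⟩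
        · refine .add_left' (isRight_overheat.2 ⟨r, hr, rfl⟩) (mk_le_mk.1 ?_)
          simp only [mk_add]
          rw [add_right_comm]
          exact add_le_add_left (xr r hr y).2 _
        · refine .add_right' (isRight_overheat.2 ⟨r, hr, rfl⟩) (mk_le_mk.1 ?_)
          simp only [mk_add]
          rw [← add_assoc]
          exact add_le_add_left (yr r hr).2 _

theorem mk_overheat_add (K x y : PartizanGame) :
    mk (overheat K (add x y)) = mk (overheat K x) + mk (overheat K y) :=
  le_antisymm (mk_overheat_add_le K x y).1 (mk_overheat_add_le K x y).2

theorem mk_overheat_neg_le (K x : PartizanGame) :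
    mk (overheat K (neg x)) ≤ - mk (overheat K x) ∧
      - mk (overheat K x) ≤ mk (overheat K (neg x)) := by
  induction x using opt_induction with
  | h x xl xr =>
    refine ⟨.intro ?_ ?_, .intro ?_ ?_⟩
    · intro l hl
      rw [isLeft_overheat] at hl
      obtain ⟨l, hl, rfl⟩ := hl
      rw [isLeft_neg] at hl
      obtain ⟨r, hr, rfl⟩ := hl
      refine .left (isLeft_neg.2 ⟨_, isRight_overheat.2 ⟨r, hr, rfl⟩, rfl⟩) (mk_le_mk.1 ?_)
      simp only [mk_add, mk_neg, neg_add_rev, neg_neg]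
      rw [add_comm]
      exact add_le_add_right (xr r hr).1 _
    · intro r hr
      rw [isRight_neg] at hr
      obtain ⟨l, hl, rfl⟩ := hr
      rw [isLeft_overheat] at hl
      obtain ⟨l, hl, rfl⟩ := hl
      refine .right (isRight_overheat.2 ⟨_, isRight_neg.2 ⟨l, hl, rfl⟩, rfl⟩) (mk_le_mk.1 ?_)
      simp only [mk_add, mk_neg, neg_add_rev]
      rw [add_comm]
      exact add_le_add_right (xl l hl).1 _
    · intro l hl
      rw [isLeft_neg] at hl
      obtain ⟨r, hr, rfl⟩ := hl
      rw [isRight_overheat] at hr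
      obtain ⟨r, hr, rfl⟩ := hr
      refine .left (isLeft_overheat.2 ⟨_, isLeft_neg.2 ⟨r, hr, rfl⟩, rfl⟩) (mk_le_mk.1 ?_)
      simp only [mk_add, mk_neg, neg_add_rev, neg_neg]
      rw [add_comm (mk K)]
      exact add_le_add_left (xr r hr).2 _
    · intro r hr
      rw [isRight_overheat] at hr
      obtain ⟨r, hr, rfl⟩ := hr
      rw [isRight_neg] at hr
      obtain ⟨l, hl, rfl⟩ := hr
      refine .right (isRight_neg.2 ⟨_, isLeft_overheat.2 ⟨l, hl, rfl⟩, rfl⟩) (mk_le_mk.1 ?_)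
      simp only [mk_add, mk_neg, neg_add_rev]
      rw [add_comm (-mk K)]
      exact add_le_add_left (xl l hl).2 _

theorem mk_overheat_neg (K x : PartizanGame) :
    mk (overheat K (neg x)) = - mk (overheat K x) :=
  le_antisymm (mk_overheat_neg_le K x).1 (mk_overheat_neg_le K x).2

theorem overheat_nonneg (K x : PartizanGame) (h : Le zero x) : Le zero (overheat K x) := by
  revert h
  suffices H : (Le zero x → Le zero (overheat K x)) ∧
      ∀ l, IsLeft l x → Le zero l → Le zero (overheat K l) from H.1
  induction x using opt_induction with
  | h x xl xr =>
    refine ⟨fun h => .intro (fun l hl => (not_isLeft_zero _ hl).elim) ?_,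
      fun l hl => (xl l hl).1⟩
    intro r hr
    rw [isRight_overheat] at hr
    obtain ⟨r, hr, rfl⟩ := hr
    rcases lf_iff.1 ((le_iff.1 h).2 r hr) with ⟨l, hl, h'⟩ | ⟨r', hr', _⟩
    · refine .add_left (isLeft_overheat.2 ⟨l, hl, rfl⟩) (mk_le_mk.1 ?_)
      simp only [mk_add, mk_neg, add_neg_cancel_right]
      exact (xr r hr).2 l hl h'
    · exact (not_isRight_zero _ hr').elim

theorem overheat_mono (K : PartizanGame) {x y : PartizanGame} (h : Le x y) :
    Le (overheat K x) (overheat K y) := by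
  have h1 : Le zero (add y (neg x)) := mk_le_mk.1 (by
    rw [mk_add, mk_neg]
    exact le_trans (le_of_eq (add_neg_cancel (mk x)).symm) (add_le_add_left (mk_le_mk.2 h) _))
  have h2 : (0 : Pg) ≤ mk (overheat K (add y (neg x))) := overheat_nonneg K _ h1
  rw [mk_overheat_add, mk_overheat_neg, ← sub_eq_add_neg, sub_nonneg] at h2
  exact h2

/-- The value `*`. -/
def star : Pg := mk PartizanGame.star

/-- The overheating operation `∫_1^{1*} = f_{1*}` with `1* = 1 + *`, as an endomorphism of
the group `Pg`. -/
def overheat : Pg →+ Pg where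
  toFun := Quotient.map (PartizanGame.overheat (add (ofInt 1) PartizanGame.star))
    fun _ _ h => ⟨overheat_mono _ h.1, overheat_mono _ h.2⟩
  map_zero' := by
    refine le_antisymm (Le.intro (fun l hl => ?_) fun r hr => ?_)
      (Le.intro (fun l hl => ?_) fun r hr => ?_)
    · rw [isLeft_overheat] at hl
      obtain ⟨l, hl, rfl⟩ := hl
      exact (not_isLeft_zero _ hl).elim
    · exact (not_isRight_zero _ hr).elim
    · exact (not_isLeft_zero _ hl).elim
    · rw [isRight_overheat] at hr
      obtain ⟨l, hl, rfl⟩ := hr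
      exact (not_isRight_zero _ hl).elim
  map_add' := by rintro ⟨x⟩ ⟨y⟩; exact mk_overheat_add _ x y

theorem overheat_monotone : Monotone overheat := by
  rintro ⟨x⟩ ⟨y⟩ h; exact overheat_mono _ h

/-- The `n`-fold iterate of `∫_1^{1*}`. -/
def iter : ℕ → Pg →+ Pg
  | 0 => AddMonoidHom.id Pg
  | n + 1 => overheat.comp (iter n)

theorem iter_add (m n : ℕ) (x : Pg) : iter (m + n) x = iter m (iter n x) := by
  induction m with
  | zero => rw [Nat.zero_add]; rfl
  | succ m ih => rw [Nat.succ_add]; exact congrArg overheat ih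

theorem iter_monotone (n : ℕ) : Monotone (iter n) := by
  induction n with
  | zero => exact fun x y h => h
  | succ n ih => exact overheat_monotone.comp ih

/-- The transition maps of the sequence `Pg → Pg → Pg → ⋯` all of whose steps are `∫_1^{1*}`. -/
def transition (i j : ℕ) (_ : i ≤ j) : Pg →+ Pg := iter (j - i)

theorem transition_monotone (i j : ℕ) (h : i ≤ j) : Monotone (transition i j h) :=
  iter_monotone _

instance : DirectedSystem (fun _ : ℕ => Pg) (fun i j h => transition i j h) where
  map_self i x := by rw [transition, Nat.sub_self]; rfl
  map_map k j i hij hjk x := by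
    have h : k - i = (k - j) + (j - i) := by omega
    simp only [transition, h, iter_add]

/-- The direct limit of `Pg → Pg → Pg → ⋯` along `∫_1^{1*}`. -/
def Limit : Type 1 := DirectLimit (fun _ : ℕ => Pg) transition

namespace Limit

instance : AddCommGroup Limit :=
  inferInstanceAs (AddCommGroup (DirectLimit (fun _ : ℕ => Pg) transition))

/-- The canonical map of the `n`-th copy of `Pg` to the direct limit. -/
def of (n : ℕ) : Pg →+ Limit where
  toFun x := (Quotient.mk _ ⟨n, x⟩ : DirectLimit (fun _ : ℕ => Pg) transition)
  map_zero' := (DirectLimit.zero_def (f := transition) n).symm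
  map_add' x y := (DirectLimit.add_def (f := transition) n x y).symm

theorem of_transition (n m : ℕ) (h : n ≤ m) (x : Pg) : of m (transition n m h x) = of n x :=
  Quotient.sound ⟨m, le_rfl, h, DirectedSystem.map_map' transition h le_rfl x⟩

theorem of_eq_of {n m : ℕ} {x y : Pg} (h : of n x = of m y) :
    ∃ (k : ℕ) (hn : n ≤ k) (hm : m ≤ k), transition n k hn x = transition m k hm y :=
  Quotient.exact h

theorem exists_of (x : Limit) : ∃ n a, x = of n a := DirectLimit.exists_eq_mk transition x

theorem exists_of₂ (x y : Limit) : ∃ n a b, x = of n a ∧ y = of n b :=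
  DirectLimit.exists_eq_mk₂ transition x y

/-- The order of the direct limit: `x ≤ y` if and only if `x` and `y` are represented in some copy
of `Pg` by elements `a ≤ b`. -/
instance : PartialOrder Limit where
  le x y := ∃ (n : ℕ) (a b : Pg), x = of n a ∧ y = of n b ∧ a ≤ b
  le_refl x := by
    obtain ⟨n, a, rfl⟩ := exists_of x
    exact ⟨n, a, a, rfl, rfl, le_rfl⟩
  le_trans := by
    rintro x y z ⟨n, a, b, rfl, rfl, hab⟩ ⟨m, c, d, hc, rfl, hcd⟩
    obtain ⟨k, hn, hm, e⟩ := of_eq_of hc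
    exact ⟨k, _, _, (of_transition n k hn a).symm, (of_transition m k hm d).symm,
      (transition_monotone n k hn hab).trans (e.le.trans (transition_monotone m k hm hcd))⟩
  le_antisymm := by
    rintro x y ⟨n, a, b, rfl, rfl, hab⟩ ⟨m, c, d, hc, hd, hcd⟩
    obtain ⟨k, hn, hm, e⟩ := of_eq_of hc
    obtain ⟨l, hn', hm', e'⟩ := of_eq_of hd
    obtain ⟨N, hk, hl⟩ := exists_ge_ge k l
    rw [← of_transition n N (hn.trans hk) a, ← of_transition n N (hn.trans hk) b]
    refine congrArg (of N) (le_antisymm (transition_monotone _ _ _ hab) ?_)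
    have e1 := congrArg (transition k N hk) e
    have e2 := congrArg (transition l N hl) e'
    simp only [DirectedSystem.map_map' transition] at e1 e2
    exact e1.le.trans ((transition_monotone _ _ _ hcd).trans e2.ge)

instance : IsOrderedAddMonoid Limit where
  add_le_add_left := by
    rintro x y ⟨n, a, b, rfl, rfl, hab⟩ z
    obtain ⟨m, c, rfl⟩ := exists_of z
    refine ⟨n + m, transition n _ (Nat.le_add_right n m) a + transition m _ (Nat.le_add_left m n) c,
      transition n _ (Nat.le_add_right n m) b + transition m _ (Nat.le_add_left m n) c, ?_, ?_,
      add_le_add_left (transition_monotone _ _ _ hab) _⟩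
    · rw [map_add, of_transition, of_transition]
    · rw [map_add, of_transition, of_transition]

end Limit

end Pg

/-! ### Well-tempered scoring games -/

/-- Finite integer-valued scoring games: an integer, or a pair `{L | R}` of finite nonempty
families of games. -/
inductive ScoringGame : Type 1
  | int (n : ℤ) : ScoringGame
  | node (α β : Type) [Finite α] [Finite β] [Nonempty α] [Nonempty β]
      (L : α → ScoringGame) (R : β → ScoringGame) : ScoringGame

namespace ScoringGame

/-- `l` is a left option of the game (integers have no options). -/
def IsLeft (l : ScoringGame) : ScoringGame → Prop
  | int _ => False
  | node _ _ L _ => ∃ i, L i = l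

/-- `r` is a right option of the game (integers have no options). -/
def IsRight (r : ScoringGame) : ScoringGame → Prop
  | int _ => False
  | node _ _ _ R => ∃ j, R j = r

/-- `HasParity G 0`: `G` is an even-tempered game; `HasParity G 1`: `G` is an odd-tempered game.
Integers are even-tempered, and all options of a game have the parity opposite to its own. -/
def HasParity : ScoringGame → ZMod 2 → Prop
  | int _, p => p = 0
  | node _ _ L R, p => (∀ i, HasParity (L i) (p + 1)) ∧ ∀ j, HasParity (R j) (p + 1)

/-- Even-tempered games. -/
def IsEven (G : ScoringGame) : Prop := G.HasParity 0

/-- Odd-tempered games. -/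
def IsOdd (G : ScoringGame) : Prop := G.HasParity 1

/-- Well-tempered games. -/
def WellTempered (G : ScoringGame) : Prop := G.IsEven ∨ G.IsOdd

mutual

/-- The left outcome `L(G)`: the score under perfect play when Left moves first. -/
def left : ScoringGame → ℤ
  | int n => n
  | node _ _ L _ => ⨆ i, right (L i)

/-- The right outcome `R(G)`: the score under perfect play when Right moves first. -/
def right : ScoringGame → ℤ
  | int n => n
  | node _ _ _ R => ⨅ j, left (R j)

end

/-- The disjunctive sum `G + H`: the usual sum if both games are integers, and
`{G^L + H, G + H^L | G^R + H, G + H^R}` otherwise. -/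
def add (G : ScoringGame) : ScoringGame → ScoringGame :=
  ScoringGame.rec (motive := fun _ => ScoringGame → ScoringGame)
    (fun a H =>
      ScoringGame.rec (motive := fun _ => ScoringGame)
        (fun b => int (a + b))
        (fun α' β' _ _ _ _ _ _ ihL' ihR' => node α' β' ihL' ihR') H)
    (fun α β _ _ _ _ _ _ ihL ihR H =>
      ScoringGame.rec (motive := fun _ => ScoringGame)
        (fun b => node α β (fun i => ihL i (int b)) (fun j => ihR j (int b)))
        (fun α' β' _ _ _ _ L' R' ihL' ihR' =>
          node (α ⊕ α') (β ⊕ β')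
            (Sum.elim (fun i => ihL i (node α' β' L' R')) ihL')
            (Sum.elim (fun j => ihR j (node α' β' L' R')) ihR')) H) G

section

variable (α β : Type) [Finite α] [Finite β] [Nonempty α] [Nonempty β]
  (L : α → ScoringGame) (R : β → ScoringGame)
  (α' β' : Type) [Finite α'] [Finite β'] [Nonempty α'] [Nonempty β']
  (L' : α' → ScoringGame) (R' : β' → ScoringGame)

theorem int_add_int (a b : ℤ) : add (int a) (int b) = int (a + b) := rfl

theorem int_add_node (a : ℤ) : add (int a) (node α' β' L' R') =
    node α' β' (fun i => add (int a) (L' i)) (fun j => add (int a) (R' j)) := rfl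

theorem node_add_int (b : ℤ) : add (node α β L R) (int b) =
    node α β (fun i => add (L i) (int b)) (fun j => add (R j) (int b)) := rfl

theorem node_add_node : add (node α β L R) (node α' β' L' R') =
    node (α ⊕ α') (β ⊕ β')
      (Sum.elim (fun i => add (L i) (node α' β' L' R')) (fun i => add (node α β L R) (L' i)))
      (Sum.elim (fun j => add (R j) (node α' β' L' R')) (fun j => add (node α β L R) (R' j))) :=
  rfl

end

/-- The negative `-G = {-G^R | -G^L}`. -/
def neg : ScoringGame → ScoringGame
  | int n => int (-n)
  | node α β L R => node β α (fun j => neg (R j)) (fun i => neg (L i))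

/-- Heating: `∫^t G = {t + ∫^t G^L | -t + ∫^t G^R}`, and `∫^t n = n` for integers `n`. -/
def heat (t : ℤ) : ScoringGame → ScoringGame
  | int n => int n
  | node α β L R =>
      node α β (fun i => add (int t) (heat t (L i))) (fun j => add (int (-t)) (heat t (R j)))

/-- `Subgame H G`: `H` is a subgame of `G`, that is, `G` or a subgame of an option of `G`. -/
inductive Subgame (H : ScoringGame) : ScoringGame → Prop
  | refl : Subgame H H
  | left {G l : ScoringGame} (hl : IsLeft l G) (h : Subgame H l) : Subgame H G
  | right {G r : ScoringGame} (hr : IsRight r G) (h : Subgame H r) : Subgame H G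

/-- `gap_i(G)`: the supremum of `R(H) - L(H)` over the subgames `H` of `G` of parity `i`
(`-∞` if there are none). -/
def gap (i : ZMod 2) (G : ScoringGame) : EReal :=
  ⨆ (H : ScoringGame) (_ : Subgame H G) (_ : HasParity H i), (((H.right - H.left : ℤ) : ℝ) : EReal)

/-- The class `I` of well-tempered games with `gap_0(G) = 0`. -/
def InI (G : ScoringGame) : Prop := G.WellTempered ∧ G.gap 0 = 0

/-- The class `F_n` of well-tempered games with `gap_0(G) = 0` and `gap_1(G) ≤ 2n`. -/
def InF (n : ℕ) (G : ScoringGame) : Prop := G.InI ∧ G.gap 1 ≤ 2 * n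

/-- The class `J` of well-tempered games with `gap_0(G) = 0` and `gap_1(G) ≤ 2`. -/
def InJ (G : ScoringGame) : Prop := G.InI ∧ G.gap 1 ≤ 2

/-- The map `G ↦ {ψ(G^L) | ψ(G^R)}` on the level of forms. -/
def psiForm : ScoringGame → PartizanGame
  | int n => PartizanGame.ofInt n
  | node α β L R => PartizanGame.mk α β (fun i => psiForm (L i)) (fun j => psiForm (R j))

/-- The map `ψ` from scoring games to the group `Pg`. -/
def psi (G : ScoringGame) : Pg := Pg.mk G.psiForm

/-! Basic facts needed for the ordered monoid structure on games modulo equivalence. -/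

theorem opt_induction {P : ScoringGame → Prop}
    (h : ∀ x, (∀ l, IsLeft l x → P l) → (∀ r, IsRight r x → P r) → P x) (x : ScoringGame) :
    P x := by
  induction x with
  | int n => exact h _ (by rintro _ ⟨⟩) (by rintro _ ⟨⟩)
  | node α β L R ihL ihR =>
    exact h _ (by rintro _ ⟨i, rfl⟩; exact ihL i) (by rintro _ ⟨j, rfl⟩; exact ihR j)

theorem int_or (G : ScoringGame) :
    (∃ n, G = int n) ∨ ((∃ l, IsLeft l G) ∧ ∃ r, IsRight r G) := by
  cases G with
  | int n => exact .inl ⟨n, rfl⟩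
  | node α β L R =>
    exact .inr ⟨⟨_, Classical.arbitrary α, rfl⟩, ⟨_, Classical.arbitrary β, rfl⟩⟩

theorem right_le_left {l G : ScoringGame} (h : IsLeft l G) : l.right ≤ G.left := by
  cases G with
  | int n => exact h.elim
  | node α β L R =>
    obtain ⟨i, rfl⟩ := h
    rw [left]
    exact le_ciSup (f := fun i => (L i).right) (Set.finite_range _).bddAbove i

theorem right_le_left' {r G : ScoringGame} (h : IsRight r G) : G.right ≤ r.left := by
  cases G with
  | int n => exact h.elim
  | node α β L R =>
    obtain ⟨j, rfl⟩ := h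
    rw [right]
    exact ciInf_le (f := fun j => (R j).left) (Set.finite_range _).bddBelow j

theorem exists_left {l G : ScoringGame} (h : IsLeft l G) :
    ∃ l', IsLeft l' G ∧ G.left = l'.right := by
  cases G with
  | int n => exact h.elim
  | node α β L R =>
    obtain ⟨i, hi⟩ := exists_eq_ciSup_of_finite (f := fun i => (L i).right)
    exact ⟨L i, ⟨i, rfl⟩, by rw [left]; exact hi.symm⟩

theorem exists_right {r G : ScoringGame} (h : IsRight r G) :
    ∃ r', IsRight r' G ∧ G.right = r'.left := by
  cases G with
  | int n => exact h.elim
  | node α β L R =>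
    obtain ⟨j, hj⟩ := exists_eq_ciInf_of_finite (f := fun j => (R j).left)
    exact ⟨R j, ⟨j, rfl⟩, by rw [right]; exact hj.symm⟩

theorem isLeft_add {z x y : ScoringGame} : IsLeft z (add x y) ↔
    (∃ l, IsLeft l x ∧ z = add l y) ∨ (∃ l, IsLeft l y ∧ z = add x l) := by
  cases x <;> cases y <;>
  simp only [int_add_int, int_add_node, node_add_int, node_add_node, IsLeft, Sum.exists,
    Sum.elim_inl, Sum.elim_inr, exists_exists_eq_and, eq_comm (a := z), false_and, exists_false,
    or_false, false_or]

theorem isRight_add {z x y : ScoringGame} : IsRight z (add x y) ↔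
    (∃ r, IsRight r x ∧ z = add r y) ∨ (∃ r, IsRight r y ∧ z = add x r) := by
  cases x <;> cases y <;>
  simp only [int_add_int, int_add_node, node_add_int, node_add_node, IsRight, Sum.exists,
    Sum.elim_inl, Sum.elim_inr, exists_exists_eq_and, eq_comm (a := z), false_and, exists_false,
    or_false, false_or]

theorem isLeft_neg {z x : ScoringGame} : IsLeft z (neg x) ↔ ∃ r, IsRight r x ∧ z = neg r := by
  cases x <;>
  simp only [neg, IsLeft, IsRight, exists_exists_eq_and, eq_comm (a := z), false_and, exists_false]

theorem isRight_neg {z x : ScoringGame} : IsRight z (neg x) ↔ ∃ l, IsLeft l x ∧ z = neg l := by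
  cases x <;>
  simp only [neg, IsLeft, IsRight, exists_exists_eq_and, eq_comm (a := z), false_and, exists_false]

theorem isLeft_add_left {l x : ScoringGame} (y : ScoringGame) (h : IsLeft l x) :
    IsLeft (add l y) (add x y) := isLeft_add.2 (.inl ⟨l, h, rfl⟩)

theorem isLeft_add_right {l x : ScoringGame} (y : ScoringGame) (h : IsLeft l x) :
    IsLeft (add y l) (add y x) := isLeft_add.2 (.inr ⟨l, h, rfl⟩)

theorem isRight_add_left {l x : ScoringGame} (y : ScoringGame) (h : IsRight l x) :
    IsRight (add l y) (add x y) := isRight_add.2 (.inl ⟨l, h, rfl⟩)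

theorem isRight_add_right {l x : ScoringGame} (y : ScoringGame) (h : IsRight l x) :
    IsRight (add y l) (add y x) := isRight_add.2 (.inr ⟨l, h, rfl⟩)

theorem add_eq_int {x y : ScoringGame} {n : ℤ} :
    add x y = int n ↔ ∃ a b, x = int a ∧ y = int b ∧ n = a + b := by
  cases x with
  | int a =>
    cases y with
    | int b =>
      rw [int_add_int]
      constructor
      · intro h
        exact ⟨a, b, rfl, rfl, (int.inj h).symm⟩
      · rintro ⟨a', b', ha, hb, rfl⟩
        rw [int.inj ha, int.inj hb]
    | node => simp [int_add_node]
  | node =>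
    cases y with
    | int b => simp [node_add_int]
    | node => simp [node_add_node]

/-- Two games with the same outcomes, stated for induction over their options. -/
theorem outcome_congr {A B : ScoringGame} (hA : ∀ n, A = int n → B = int n)
    (hl : ∀ l, IsLeft l A → ∃ l', IsLeft l' B ∧ l.right = l'.right)
    (hl' : ∀ l, IsLeft l B → ∃ l', IsLeft l' A ∧ l.right = l'.right)
    (hr : ∀ r, IsRight r A → ∃ r', IsRight r' B ∧ r.left = r'.left)
    (hr' : ∀ r, IsRight r B → ∃ r', IsRight r' A ∧ r.left = r'.left) :
    A.left = B.left ∧ A.right = B.right := by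
  rcases int_or A with ⟨n, hn⟩ | ⟨⟨l, h⟩, ⟨r, k⟩⟩
  · rw [hA n hn, hn]
    exact ⟨rfl, rfl⟩
  · obtain ⟨l', h', -⟩ := hl l h
    obtain ⟨r', k', -⟩ := hr r k
    constructor
    · obtain ⟨a, ha, ea⟩ := exists_left h
      obtain ⟨b, hb, eb⟩ := exists_left h'
      obtain ⟨a', ha', ea'⟩ := hl a ha
      obtain ⟨b', hb', eb'⟩ := hl' b hb
      exact le_antisymm (by rw [ea, ea']; exact right_le_left ha')
        (by rw [eb, eb']; exact right_le_left hb')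
    · obtain ⟨a, ha, ea⟩ := exists_right k
      obtain ⟨b, hb, eb⟩ := exists_right k'
      obtain ⟨a', ha', ea'⟩ := hr a ha
      obtain ⟨b', hb', eb'⟩ := hr' b hb
      exact le_antisymm (by rw [eb, eb']; exact right_le_left' hb')
        (by rw [ea, ea']; exact right_le_left' ha')

theorem add_comm_outcome (x y z : ScoringGame) :
    (add (add x y) z).left = (add (add y x) z).left ∧
      (add (add x y) z).right = (add (add y x) z).right := by
  induction x using opt_induction generalizing y z with
  | h x xl xr =>
    induction y using opt_induction generalizing z with
    | h y yl yr =>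
      induction z using opt_induction with
      | h z zl zr =>
        refine outcome_congr (fun n h => ?_) ?_ ?_ ?_ ?_
        · replace h := add_eq_int.1 h
          obtain ⟨_, k, h, rfl, rfl⟩ := h
          replace h := add_eq_int.1 h
          obtain ⟨i, j, rfl, rfl, rfl⟩ := h
          simp only [int_add_int, add_comm j i]
        · intro _ h
          rw [isLeft_add] at h
          rcases h with ⟨_, h, rfl⟩ | ⟨_, h, rfl⟩
          · rw [isLeft_add] at h
            rcases h with ⟨_, h, rfl⟩ | ⟨_, h, rfl⟩
            · exact ⟨_, isLeft_add_left _ (isLeft_add_right _ h), (xl _ h y z).2⟩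
            · exact ⟨_, isLeft_add_left _ (isLeft_add_left _ h), (yl _ h z).2⟩
          · exact ⟨_, isLeft_add_right _ h, (zl _ h).2⟩
        · intro _ h
          rw [isLeft_add] at h
          rcases h with ⟨_, h, rfl⟩ | ⟨_, h, rfl⟩
          · rw [isLeft_add] at h
            rcases h with ⟨_, h, rfl⟩ | ⟨_, h, rfl⟩
            · exact ⟨_, isLeft_add_left _ (isLeft_add_right _ h), (yl _ h z).2.symm⟩
            · exact ⟨_, isLeft_add_left _ (isLeft_add_left _ h), (xl _ h y z).2.symm⟩
          · exact ⟨_, isLeft_add_right _ h, (zl _ h).2.symm⟩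
        · intro _ h
          rw [isRight_add] at h
          rcases h with ⟨_, h, rfl⟩ | ⟨_, h, rfl⟩
          · rw [isRight_add] at h
            rcases h with ⟨_, h, rfl⟩ | ⟨_, h, rfl⟩
            · exact ⟨_, isRight_add_left _ (isRight_add_right _ h), (xr _ h y z).1⟩
            · exact ⟨_, isRight_add_left _ (isRight_add_left _ h), (yr _ h z).1⟩
          · exact ⟨_, isRight_add_right _ h, (zr _ h).1⟩
        · intro _ h
          rw [isRight_add] at h
          rcases h with ⟨_, h, rfl⟩ | ⟨_, h, rfl⟩
          · rw [isRight_add] at h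
            rcases h with ⟨_, h, rfl⟩ | ⟨_, h, rfl⟩
            · exact ⟨_, isRight_add_left _ (isRight_add_right _ h), (yr _ h z).1.symm⟩
            · exact ⟨_, isRight_add_left _ (isRight_add_left _ h), (xr _ h y z).1.symm⟩
          · exact ⟨_, isRight_add_right _ h, (zr _ h).1.symm⟩

theorem add_assoc_outcome (x y z w : ScoringGame) :
    (add (add (add x y) z) w).left = (add (add x (add y z)) w).left ∧
      (add (add (add x y) z) w).right = (add (add x (add y z)) w).right := by
  induction x using opt_induction generalizing y z w with
  | h x xl xr =>
    induction y using opt_induction generalizing z w with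
    | h y yl yr =>
      induction z using opt_induction generalizing w with
      | h z zl zr =>
        induction w using opt_induction with
        | h w wl wr =>
          refine outcome_congr (fun n h => ?_) ?_ ?_ ?_ ?_
          · replace h := add_eq_int.1 h
            obtain ⟨_, d, h, rfl, rfl⟩ := h
            replace h := add_eq_int.1 h
            obtain ⟨_, c, h, rfl, rfl⟩ := h
            replace h := add_eq_int.1 h
            obtain ⟨a, b, rfl, rfl, rfl⟩ := h
            simp only [int_add_int, add_assoc]
          · intro _ h
            rw [isLeft_add] at h
            rcases h with ⟨_, h, rfl⟩ | ⟨_, h, rfl⟩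
            · rw [isLeft_add] at h
              rcases h with ⟨_, h, rfl⟩ | ⟨_, h, rfl⟩
              · rw [isLeft_add] at h
                rcases h with ⟨_, h, rfl⟩ | ⟨_, h, rfl⟩
                · exact ⟨_, isLeft_add_left _ (isLeft_add_left _ h), (xl _ h y z w).2⟩
                · exact ⟨_, isLeft_add_left _ (isLeft_add_right _ (isLeft_add_left _ h)), (yl _ h z w).2⟩
              · exact ⟨_, isLeft_add_left _ (isLeft_add_right _ (isLeft_add_right _ h)), (zl _ h w).2⟩
            · exact ⟨_, isLeft_add_right _ h, (wl _ h).2⟩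
          · intro _ h
            rw [isLeft_add] at h
            rcases h with ⟨_, h, rfl⟩ | ⟨_, h, rfl⟩
            · rw [isLeft_add] at h
              rcases h with ⟨_, h, rfl⟩ | ⟨_, h, rfl⟩
              · exact ⟨_, isLeft_add_left _ (isLeft_add_left _ (isLeft_add_left _ h)), (xl _ h y z w).2.symm⟩
              · rw [isLeft_add] at h
                rcases h with ⟨_, h, rfl⟩ | ⟨_, h, rfl⟩
                · exact ⟨_, isLeft_add_left _ (isLeft_add_left _ (isLeft_add_right _ h)), (yl _ h z w).2.symm⟩
                · exact ⟨_, isLeft_add_left _ (isLeft_add_right _ h), (zl _ h w).2.symm⟩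
            · exact ⟨_, isLeft_add_right _ h, (wl _ h).2.symm⟩
          · intro _ h
            rw [isRight_add] at h
            rcases h with ⟨_, h, rfl⟩ | ⟨_, h, rfl⟩
            · rw [isRight_add] at h
              rcases h with ⟨_, h, rfl⟩ | ⟨_, h, rfl⟩
              · rw [isRight_add] at h
                rcases h with ⟨_, h, rfl⟩ | ⟨_, h, rfl⟩
                · exact ⟨_, isRight_add_left _ (isRight_add_left _ h), (xr _ h y z w).1⟩
                · exact ⟨_, isRight_add_left _ (isRight_add_right _ (isRight_add_left _ h)), (yr _ h z w).1⟩
              · exact ⟨_, isRight_add_left _ (isRight_add_right _ (isRight_add_right _ h)), (zr _ h w).1⟩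
            · exact ⟨_, isRight_add_right _ h, (wr _ h).1⟩
          · intro _ h
            rw [isRight_add] at h
            rcases h with ⟨_, h, rfl⟩ | ⟨_, h, rfl⟩
            · rw [isRight_add] at h
              rcases h with ⟨_, h, rfl⟩ | ⟨_, h, rfl⟩
              · exact ⟨_, isRight_add_left _ (isRight_add_left _ (isRight_add_left _ h)), (xr _ h y z w).1.symm⟩
              · rw [isRight_add] at h
                rcases h with ⟨_, h, rfl⟩ | ⟨_, h, rfl⟩
                · exact ⟨_, isRight_add_left _ (isRight_add_left _ (isRight_add_right _ h)), (yr _ h z w).1.symm⟩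
                · exact ⟨_, isRight_add_left _ (isRight_add_right _ h), (zr _ h w).1.symm⟩
            · exact ⟨_, isRight_add_right _ h, (wr _ h).1.symm⟩

theorem add_assoc_outcome₂ (x y z : ScoringGame) :
    (add (add x y) z).left = (add x (add y z)).left ∧
      (add (add x y) z).right = (add x (add y z)).right := by
  induction x using opt_induction generalizing y z with
  | h x xl xr =>
    induction y using opt_induction generalizing z with
    | h y yl yr =>
      induction z using opt_induction with
      | h z zl zr =>
        refine outcome_congr (fun n h => ?_) ?_ ?_ ?_ ?_
        · replace h := add_eq_int.1 h
          obtain ⟨_, k, h, rfl, rfl⟩ := h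
          replace h := add_eq_int.1 h
          obtain ⟨i, j, rfl, rfl, rfl⟩ := h
          simp only [int_add_int, add_assoc]
        · intro _ h
          rw [isLeft_add] at h
          rcases h with ⟨_, h, rfl⟩ | ⟨_, h, rfl⟩
          · rw [isLeft_add] at h
            rcases h with ⟨_, h, rfl⟩ | ⟨_, h, rfl⟩
            · exact ⟨_, isLeft_add_left _ h, (xl _ h y z).2⟩
            · exact ⟨_, isLeft_add_right _ (isLeft_add_left _ h), (yl _ h z).2⟩
          · exact ⟨_, isLeft_add_right _ (isLeft_add_right _ h), (zl _ h).2⟩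
        · intro _ h
          rw [isLeft_add] at h
          rcases h with ⟨_, h, rfl⟩ | ⟨_, h, rfl⟩
          · exact ⟨_, isLeft_add_left _ (isLeft_add_left _ h), (xl _ h y z).2.symm⟩
          · rw [isLeft_add] at h
            rcases h with ⟨_, h, rfl⟩ | ⟨_, h, rfl⟩
            · exact ⟨_, isLeft_add_left _ (isLeft_add_right _ h), (yl _ h z).2.symm⟩
            · exact ⟨_, isLeft_add_right _ h, (zl _ h).2.symm⟩
        · intro _ h
          rw [isRight_add] at h
          rcases h with ⟨_, h, rfl⟩ | ⟨_, h, rfl⟩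
          · rw [isRight_add] at h
            rcases h with ⟨_, h, rfl⟩ | ⟨_, h, rfl⟩
            · exact ⟨_, isRight_add_left _ h, (xr _ h y z).1⟩
            · exact ⟨_, isRight_add_right _ (isRight_add_left _ h), (yr _ h z).1⟩
          · exact ⟨_, isRight_add_right _ (isRight_add_right _ h), (zr _ h).1⟩
        · intro _ h
          rw [isRight_add] at h
          rcases h with ⟨_, h, rfl⟩ | ⟨_, h, rfl⟩
          · exact ⟨_, isRight_add_left _ (isRight_add_left _ h), (xr _ h y z).1.symm⟩
          · rw [isRight_add] at h
            rcases h with ⟨_, h, rfl⟩ | ⟨_, h, rfl⟩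
            · exact ⟨_, isRight_add_left _ (isRight_add_right _ h), (yr _ h z).1.symm⟩
            · exact ⟨_, isRight_add_right _ h, (zr _ h).1.symm⟩

theorem add_zero_outcome (x y : ScoringGame) :
    (add (add x (int 0)) y).left = (add x y).left ∧
      (add (add x (int 0)) y).right = (add x y).right := by
  induction x using opt_induction generalizing y with
  | h x xl xr =>
    induction y using opt_induction with
    | h y yl yr =>
      refine outcome_congr (fun n h => ?_) ?_ ?_ ?_ ?_
      · replace h := add_eq_int.1 h
        obtain ⟨_, k, h, rfl, rfl⟩ := h
        replace h := add_eq_int.1 h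
        obtain ⟨i, j, rfl, h, rfl⟩ := h
        obtain rfl : 0 = j := int.inj h
        simp only [int_add_int, add_zero]
      · intro _ h
        rw [isLeft_add] at h
        rcases h with ⟨_, h, rfl⟩ | ⟨_, h, rfl⟩
        · rw [isLeft_add] at h
          rcases h with ⟨_, h, rfl⟩ | ⟨_, h, rfl⟩
          · exact ⟨_, isLeft_add_left _ h, (xl _ h y).2⟩
          · exact h.elim
        · exact ⟨_, isLeft_add_right _ h, (yl _ h).2⟩
      · intro _ h
        rw [isLeft_add] at h
        rcases h with ⟨_, h, rfl⟩ | ⟨_, h, rfl⟩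
        · exact ⟨_, isLeft_add_left _ (isLeft_add_left _ h), (xl _ h y).2.symm⟩
        · exact ⟨_, isLeft_add_right _ h, (yl _ h).2.symm⟩
      · intro _ h
        rw [isRight_add] at h
        rcases h with ⟨_, h, rfl⟩ | ⟨_, h, rfl⟩
        · rw [isRight_add] at h
          rcases h with ⟨_, h, rfl⟩ | ⟨_, h, rfl⟩
          · exact ⟨_, isRight_add_left _ h, (xr _ h y).1⟩
          · exact h.elim
        · exact ⟨_, isRight_add_right _ h, (yr _ h).1⟩
      · intro _ h
        rw [isRight_add] at h
        rcases h with ⟨_, h, rfl⟩ | ⟨_, h, rfl⟩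
        · exact ⟨_, isRight_add_left _ (isRight_add_left _ h), (xr _ h y).1.symm⟩
        · exact ⟨_, isRight_add_right _ h, (yr _ h).1.symm⟩

theorem add_zero_outcome₂ (x : ScoringGame) :
    (add x (int 0)).left = x.left ∧ (add x (int 0)).right = x.right := by
  induction x with
  | int n => rw [int_add_int, add_zero]; exact ⟨rfl, rfl⟩
  | node α β L R ihL ihR =>
    rw [node_add_int, left, left, right, right]
    simp only [ihL, ihR, and_self]

theorem add_comm_outcome₂ (x y : ScoringGame) :
    (add x y).left = (add y x).left ∧ (add x y).right = (add y x).right := by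
  have h := add_comm_outcome x y (int 0)
  have h1 := fun z : ScoringGame => add_zero_outcome₂ z
  rw [(h1 _).1, (h1 _).1, (h1 _).2, (h1 _).2] at h
  exact h

theorem HasParity.of_isLeft {G l : ScoringGame} {p : ZMod 2} (hG : G.HasParity p)
    (h : IsLeft l G) : l.HasParity (p + 1) := by
  cases G with
  | int n => exact h.elim
  | node α β L R => obtain ⟨i, rfl⟩ := h; exact hG.1 i

theorem HasParity.of_isRight {G r : ScoringGame} {p : ZMod 2} (hG : G.HasParity p)
    (h : IsRight r G) : r.HasParity (p + 1) := by
  cases G with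
  | int n => exact h.elim
  | node α β L R => obtain ⟨i, rfl⟩ := h; exact hG.2 i

theorem hasParity_of {G : ScoringGame} {p : ZMod 2} (h : ∀ n, G = int n → p = 0)
    (hl : ∀ l, IsLeft l G → l.HasParity (p + 1)) (hr : ∀ r, IsRight r G → r.HasParity (p + 1)) :
    G.HasParity p := by
  cases G with
  | int n => exact h n rfl
  | node α β L R => exact ⟨fun i => hl _ ⟨i, rfl⟩, fun j => hr _ ⟨j, rfl⟩⟩

theorem HasParity.add {G H : ScoringGame} {p q : ZMod 2} (hG : G.HasParity p)
    (hH : H.HasParity q) : (G.add H).HasParity (p + q) := by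
  induction G using opt_induction generalizing H p q with
  | h G Gl Gr =>
    induction H using opt_induction generalizing q with
    | h H Hl Hr =>
      refine hasParity_of (fun n h => ?_) (fun l h => ?_) (fun r h => ?_)
      · obtain ⟨a, b, rfl, rfl, rfl⟩ := add_eq_int.1 h
        rw [show p = 0 from hG, show q = 0 from hH, add_zero]
      · rcases isLeft_add.1 h with ⟨l, k, rfl⟩ | ⟨l, k, rfl⟩
        · rw [add_right_comm]
          exact Gl l k (hG.of_isLeft k) hH
        · rw [add_assoc]
          exact Hl l k (hH.of_isLeft k)
      · rcases isRight_add.1 h with ⟨r, k, rfl⟩ | ⟨r, k, rfl⟩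
        · rw [add_right_comm]
          exact Gr r k (hG.of_isRight k) hH
        · rw [add_assoc]
          exact Hr r k (hH.of_isRight k)

theorem HasParity.neg {G : ScoringGame} {p : ZMod 2} (hG : G.HasParity p) :
    G.neg.HasParity p := by
  induction G using opt_induction generalizing p with
  | h G Gl Gr =>
    refine hasParity_of (fun n h => ?_) (fun l h => ?_) (fun r h => ?_)
    · cases G with
      | int n => exact hG
      | node => cases h
    · obtain ⟨r, k, rfl⟩ := isLeft_neg.1 h
      exact Gr r k (hG.of_isRight k)
    · obtain ⟨l, k, rfl⟩ := isRight_neg.1 h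
      exact Gl l k (hG.of_isLeft k)

theorem wellTempered_iff {G : ScoringGame} : G.WellTempered ↔ ∃ p, G.HasParity p := by
  constructor
  · rintro (h | h)
    · exact ⟨0, h⟩
    · exact ⟨1, h⟩
  · rintro ⟨p, h⟩
    fin_cases p
    · exact .inl h
    · exact .inr h

theorem WellTempered.add {G H : ScoringGame} (hG : G.WellTempered) (hH : H.WellTempered) :
    (G.add H).WellTempered := by
  obtain ⟨p, hp⟩ := wellTempered_iff.1 hG
  obtain ⟨q, hq⟩ := wellTempered_iff.1 hH
  exact wellTempered_iff.2 ⟨p + q, hp.add hq⟩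

theorem int_add_outcome (a : ℤ) (x : ScoringGame) :
    (add (int a) x).left = a + x.left ∧ (add (int a) x).right = a + x.right := by
  induction x with
  | int n => rw [int_add_int, left, left, right, right]; exact ⟨rfl, rfl⟩
  | node α β L R ihL ihR =>
    rw [int_add_node, left, left, right, right]
    constructor
    · simp only [ihL]
      exact ((OrderIso.addLeft a).map_ciSup (Set.finite_range fun i => (L i).right).bddAbove).symm
    · simp only [ihR]
      exact ((OrderIso.addLeft a).map_ciInf (Set.finite_range fun i => (R i).left).bddBelow).symm

theorem exists_int_subgame (G : ScoringGame) : ∃ n, Subgame (int n) G := by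
  induction G using opt_induction with
  | h G hl hr =>
    rcases int_or G with ⟨n, rfl⟩ | ⟨⟨l, h⟩, -⟩
    · exact ⟨n, .refl⟩
    · obtain ⟨n, hn⟩ := hl l h
      exact ⟨n, .left h hn⟩

theorem gap_zero_eq_zero_iff {G : ScoringGame} :
    G.gap 0 = 0 ↔ ∀ H, Subgame H G → H.IsEven → H.right ≤ H.left := by
  have h0 : 0 ≤ G.gap 0 := by
    obtain ⟨n, hn⟩ := exists_int_subgame G
    refine le_trans (le_of_eq ?_) (le_iSup₂_of_le (int n) hn (le_iSup_of_le (rfl : (0 : ZMod 2) = 0)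
      le_rfl))
    simp [left, right]
  rw [show G.gap 0 = 0 ↔ G.gap 0 ≤ 0 from le_antisymm_iff.trans (and_iff_left h0)]
  simp only [gap, iSup_le_iff, IsEven]
  refine forall₃_congr fun H _ _ => ?_
  rw [← sub_nonpos (a := H.right)]
  exact_mod_cast Iff.rfl

theorem subgame_trans_left {G l : ScoringGame} (hl : IsLeft l G)
    (h : ∀ H, Subgame H G → H.IsEven → H.right ≤ H.left) :
    ∀ H, Subgame H l → H.IsEven → H.right ≤ H.left := fun H k => h H (.left hl k)

theorem subgame_trans_right {G r : ScoringGame} (hr : IsRight r G)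
    (h : ∀ H, Subgame H G → H.IsEven → H.right ≤ H.left) :
    ∀ H, Subgame H r → H.IsEven → H.right ≤ H.left := fun H k => h H (.right hr k)

theorem not_isOdd_int {n : ℤ} (h : (int n).IsOdd) : False := one_ne_zero (α := ZMod 2) h

theorem outcome_lower (H G : ScoringGame) (hH : ∀ K, Subgame K H → K.IsEven → K.right ≤ K.left) :
    (H.IsEven → G.right + H.right ≤ (add G H).right ∧ G.left + H.right ≤ (add G H).left) ∧
      (H.IsOdd → G.right + H.left ≤ (add G H).left) := by
  induction H using opt_induction generalizing G with
  | h H Hl Hr =>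
    induction G using opt_induction with
    | h G Gl Gr =>
      refine ⟨fun hp => ⟨?_, ?_⟩, fun hp => ?_⟩
      · rcases int_or (add G H) with ⟨n, hn⟩ | ⟨-, ⟨r, hr⟩⟩
        · obtain ⟨a, b, rfl, rfl, rfl⟩ := add_eq_int.1 hn
          rw [hn, right, right, right]
        · obtain ⟨r, hr, e⟩ := exists_right hr
          rw [e]
          rcases isRight_add.1 hr with ⟨s, hs, rfl⟩ | ⟨s, hs, rfl⟩
          · have := ((Gr s hs).1 hp).2
            have := right_le_left' hs
            omega
          · have := (Hr s hs G (subgame_trans_right hs hH)).2 (hp.of_isRight hs)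
            have := right_le_left' hs
            omega
      · rcases int_or G with ⟨a, rfl⟩ | ⟨⟨l, hl⟩, -⟩
        · rw [(int_add_outcome a H).1, left]
          have := hH H .refl hp
          omega
        · obtain ⟨l, hl, e⟩ := exists_left hl
          have := ((Gl l hl).1 hp).1
          have := right_le_left (isLeft_add_left H hl)
          omega
      · rcases int_or H with ⟨b, rfl⟩ | ⟨⟨l, hl⟩, -⟩
        · exact (not_isOdd_int hp).elim
        · obtain ⟨l, hl, e⟩ := exists_left hl
          have := ((Hl l hl G (subgame_trans_left hl hH)).1 (hp.of_isLeft hl)).1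
          have := right_le_left (isLeft_add_right G hl)
          omega

theorem outcome_upper (H G : ScoringGame) (hH : ∀ K, Subgame K H → K.IsEven → K.right ≤ K.left) :
    (H.IsEven → (add G H).left ≤ G.left + H.left ∧ (add G H).right ≤ G.right + H.left) ∧
      (H.IsOdd → (add G H).right ≤ G.left + H.right) := by
  induction H using opt_induction generalizing G with
  | h H Hl Hr =>
    induction G using opt_induction with
    | h G Gl Gr =>
      refine ⟨fun hp => ⟨?_, ?_⟩, fun hp => ?_⟩
      · rcases int_or (add G H) with ⟨n, hn⟩ | ⟨⟨l, hl⟩, -⟩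
        · obtain ⟨a, b, rfl, rfl, rfl⟩ := add_eq_int.1 hn
          rw [hn, left, left, left]
        · obtain ⟨l, hl, e⟩ := exists_left hl
          rw [e]
          rcases isLeft_add.1 hl with ⟨s, hs, rfl⟩ | ⟨s, hs, rfl⟩
          · have := ((Gl s hs).1 hp).2
            have := right_le_left hs
            omega
          · have := (Hl s hs G (subgame_trans_left hs hH)).2 (hp.of_isLeft hs)
            have := right_le_left hs
            omega
      · rcases int_or G with ⟨a, rfl⟩ | ⟨-, ⟨r, hr⟩⟩
        · rw [(int_add_outcome a H).2, right]
          have := hH H .refl hp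
          omega
        · obtain ⟨r, hr, e⟩ := exists_right hr
          have := ((Gr r hr).1 hp).1
          have := right_le_left' (isRight_add_left H hr)
          omega
      · rcases int_or H with ⟨b, rfl⟩ | ⟨-, ⟨r, hr⟩⟩
        · exact (not_isOdd_int hp).elim
        · obtain ⟨r, hr, e⟩ := exists_right hr
          have := ((Hr r hr G (subgame_trans_right hr hH)).1 (hp.of_isRight hr)).1
          have := right_le_left' (isRight_add_right G hr)
          omega

theorem Subgame.of_add {K G H : ScoringGame} (h : Subgame K (add G H)) :
    ∃ G' H', Subgame G' G ∧ Subgame H' H ∧ K = add G' H' := by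
  induction G using opt_induction generalizing H with
  | h G Gl Gr =>
    induction H using opt_induction with
    | h H Hl Hr =>
      cases h with
      | refl => exact ⟨G, H, .refl, .refl, rfl⟩
      | left hl h =>
        rcases isLeft_add.1 hl with ⟨l, k, rfl⟩ | ⟨l, k, rfl⟩
        · obtain ⟨G', H', h1, h2, e⟩ := Gl l k h
          exact ⟨G', H', .left k h1, h2, e⟩
        · obtain ⟨G', H', h1, h2, e⟩ := Hl l k h
          exact ⟨G', H', h1, .left k h2, e⟩
      | right hr h =>
        rcases isRight_add.1 hr with ⟨l, k, rfl⟩ | ⟨l, k, rfl⟩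
        · obtain ⟨G', H', h1, h2, e⟩ := Gr l k h
          exact ⟨G', H', .right k h1, h2, e⟩
        · obtain ⟨G', H', h1, h2, e⟩ := Hr l k h
          exact ⟨G', H', h1, .right k h2, e⟩

theorem HasParity.of_subgame {G H : ScoringGame} {p : ZMod 2} (hG : G.HasParity p)
    (h : Subgame H G) : H.WellTempered := by
  induction h generalizing p with
  | refl => exact wellTempered_iff.2 ⟨p, hG⟩
  | left hl _ ih => exact ih (hG.of_isLeft hl)
  | right hr _ ih => exact ih (hG.of_isRight hr)

theorem HasParity.unique {G : ScoringGame} {p q : ZMod 2} (hp : G.HasParity p)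
    (hq : G.HasParity q) : p = q := by
  induction G using opt_induction generalizing p q with
  | h G Gl Gr =>
    rcases int_or G with ⟨n, rfl⟩ | ⟨⟨l, hl⟩, -⟩
    · exact Eq.trans (show p = 0 from hp) (show q = 0 from hq).symm
    · exact add_right_cancel (Gl l hl (hp.of_isLeft hl) (hq.of_isLeft hl))

theorem Subgame.trans {K H G : ScoringGame} (h : Subgame K H) (h' : Subgame H G) :
    Subgame K G := by
  induction h' with
  | refl => exact h
  | left hl _ ih => exact .left hl ih
  | right hr _ ih => exact .right hr ih

theorem InI.of_subgame {G H : ScoringGame} (hG : G.InI) (h : Subgame H G) : H.InI := by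
  obtain ⟨p, hp⟩ := wellTempered_iff.1 hG.1
  exact ⟨hp.of_subgame h,
    gap_zero_eq_zero_iff.2 fun K hK => gap_zero_eq_zero_iff.1 hG.2 K (hK.trans h)⟩

theorem InI.add {G H : ScoringGame} (hG : G.InI) (hH : H.InI) : (add G H).InI := by
  refine ⟨hG.1.add hH.1, gap_zero_eq_zero_iff.2 fun K hK hp => ?_⟩
  obtain ⟨A, B, hA, hB, rfl⟩ := hK.of_add
  replace hA := hG.of_subgame hA
  replace hB := hH.of_subgame hB
  have lo := outcome_lower B A (gap_zero_eq_zero_iff.1 hB.2)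
  have lo' := outcome_lower A B (gap_zero_eq_zero_iff.1 hA.2)
  have up := outcome_upper B A (gap_zero_eq_zero_iff.1 hB.2)
  have up' := outcome_upper A B (gap_zero_eq_zero_iff.1 hA.2)
  have c := add_comm_outcome₂ A B
  rcases hA.1 with pA | pA <;> rcases hB.1 with pB | pB
  · have := (lo'.1 pA).2
    have := (up.1 pB).2
    omega
  · exact absurd (HasParity.unique hp (pA.add pB)) (by decide)
  · exact absurd (HasParity.unique hp (pA.add pB)) (by decide)
  · have := lo.2 pB
    have := up'.2 pA
    omega

theorem neg_outcome (G : ScoringGame) : G.neg.left = -G.right ∧ G.neg.right = -G.left := by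
  induction G using opt_induction with
  | h G Gl Gr =>
    rcases int_or G with ⟨n, rfl⟩ | ⟨⟨l, hl⟩, ⟨r, hr⟩⟩
    · exact ⟨rfl, rfl⟩
    · constructor
      · obtain ⟨r, hr, e⟩ := exists_right hr
        obtain ⟨_, hl', e'⟩ := exists_left (isLeft_neg.2 ⟨r, hr, rfl⟩)
        have h1 := right_le_left (isLeft_neg.2 ⟨r, hr, rfl⟩)
        obtain ⟨s, hs, rfl⟩ := isLeft_neg.1 hl'
        have h2 := right_le_left' hs
        have := (Gr r hr).2
        have := (Gr s hs).2
        omega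
      · obtain ⟨l, hl, e⟩ := exists_left hl
        obtain ⟨_, hr', e'⟩ := exists_right (isRight_neg.2 ⟨l, hl, rfl⟩)
        have h1 := right_le_left' (isRight_neg.2 ⟨l, hl, rfl⟩)
        obtain ⟨s, hs, rfl⟩ := isRight_neg.1 hr'
        have h2 := right_le_left hs
        have := (Gl l hl).1
        have := (Gl s hs).1
        omega

theorem Subgame.of_neg {K G : ScoringGame} (h : Subgame K (neg G)) :
    ∃ G', Subgame G' G ∧ K = neg G' := by
  induction G using opt_induction with
  | h G Gl Gr =>
    cases h with
    | refl => exact ⟨G, .refl, rfl⟩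
    | left hl h =>
      obtain ⟨r, k, rfl⟩ := isLeft_neg.1 hl
      obtain ⟨G', h1, e⟩ := Gr r k h
      exact ⟨G', .right k h1, e⟩
    | right hr h =>
      obtain ⟨l, k, rfl⟩ := isRight_neg.1 hr
      obtain ⟨G', h1, e⟩ := Gl l k h
      exact ⟨G', .left k h1, e⟩

theorem WellTempered.neg {G : ScoringGame} (hG : G.WellTempered) : G.neg.WellTempered :=
  Or.imp HasParity.neg HasParity.neg hG

theorem InI.neg {G : ScoringGame} (hG : G.InI) : G.neg.InI := by
  refine ⟨hG.1.neg, gap_zero_eq_zero_iff.2 fun K hK hp => ?_⟩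
  obtain ⟨A, hA, rfl⟩ := hK.of_neg
  replace hA := hG.of_subgame hA
  rw [(neg_outcome A).1, (neg_outcome A).2]
  rcases hA.1 with pA | pA
  · have := gap_zero_eq_zero_iff.1 hA.2 A .refl pA
    omega
  · exact absurd (HasParity.unique hp pA.neg) (by decide)

theorem mirror (G : ScoringGame) :
    0 ≤ (add G (neg G)).right ∧ (add G (neg G)).left ≤ 0 := by
  induction G using opt_induction with
  | h G Gl Gr =>
    rcases int_or (add G (neg G)) with ⟨n, hn⟩ | ⟨⟨l, hl⟩, ⟨r, hr⟩⟩
    · obtain ⟨a, b, rfl, h, rfl⟩ := add_eq_int.1 hn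
      obtain rfl := int.inj h
      rw [hn, left, right]
      omega
    · constructor
      · obtain ⟨_, hr, e⟩ := exists_right hr
        rw [e]
        rcases isRight_add.1 hr with ⟨s, hs, rfl⟩ | ⟨s, hs, rfl⟩
        · exact (Gr s hs).1.trans
            (right_le_left (isLeft_add_right s (isLeft_neg.2 ⟨s, hs, rfl⟩)))
        · rw [isRight_neg] at hs
          obtain ⟨s, hs, rfl⟩ := hs
          exact (Gl s hs).1.trans (right_le_left (isLeft_add_left _ hs))
      · obtain ⟨_, hl, e⟩ := exists_left hl
        rw [e]
        rcases isLeft_add.1 hl with ⟨s, hs, rfl⟩ | ⟨s, hs, rfl⟩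
        · exact (right_le_left' (isRight_add_right s (isRight_neg.2 ⟨s, hs, rfl⟩))).trans
            (Gl s hs).2
        · rw [isLeft_neg] at hs
          obtain ⟨s, hs, rfl⟩ := hs
          exact (right_le_left' (isRight_add_left _ hs)).trans (Gr s hs).2

end ScoringGame

/-- The class of well-tempered scoring games. -/
def WellTemperedGame : Type 1 := {G : ScoringGame // G.WellTempered}

namespace WellTemperedGame

/-- The disjunctive sum of well-tempered games. -/
def add (G H : WellTemperedGame) : WellTemperedGame := ⟨G.1.add H.1, G.2.add H.2⟩

/-- Equivalence `G ≈ H`: `L(G + X) = L(H + X)` and `R(G + X) = R(H + X)` for every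
well-tempered game `X`. -/
instance setoid : Setoid WellTemperedGame where
  r G H := ∀ X : WellTemperedGame,
    (G.add X).1.left = (H.add X).1.left ∧ (G.add X).1.right = (H.add X).1.right
  iseqv := ⟨fun _ _ => ⟨rfl, rfl⟩, fun h X => ⟨(h X).1.symm, (h X).2.symm⟩,
    fun h h' X => ⟨(h X).1.trans (h' X).1, (h X).2.trans (h' X).2⟩⟩

/-- The relation `G ≲ H`: `L(G + X) ≤ L(H + X)` and `R(G + X) ≤ R(H + X)` for every
well-tempered game `X`. -/
def Le (G H : WellTemperedGame) : Prop := ∀ X : WellTemperedGame,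
  (G.add X).1.left ≤ (H.add X).1.left ∧ (G.add X).1.right ≤ (H.add X).1.right

theorem Le.add {G G' H H' : WellTemperedGame} (hG : Le G G') (hH : Le H H') :
    Le (G.add H) (G'.add H') := by
  have key : ∀ {A B : WellTemperedGame} (C : WellTemperedGame), Le A B →
      Le (A.add C) (B.add C) := by
    intro A B C h X
    have := h (C.add X)
    have e := fun D : WellTemperedGame => ScoringGame.add_assoc_outcome₂ D.1 C.1 X.1
    exact ⟨(e A).1.le.trans (this.1.trans (e B).1.ge), (e A).2.le.trans (this.2.trans (e B).2.ge)⟩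
  intro X
  have h1 := key H hG X
  have h2 := key G' hH X
  have c1 := ScoringGame.add_comm_outcome G'.1 H.1 X.1
  have c2 := ScoringGame.add_comm_outcome G'.1 H'.1 X.1
  exact ⟨h1.1.trans (c1.1.le.trans (h2.1.trans c2.1.ge)),
    h1.2.trans (c1.2.le.trans (h2.2.trans c2.2.ge))⟩

theorem equiv_iff {G H : WellTemperedGame} : G ≈ H ↔ Le G H ∧ Le H G :=
  ⟨fun h => ⟨fun X => ⟨(h X).1.le, (h X).2.le⟩, fun X => ⟨(h X).1.ge, (h X).2.ge⟩⟩,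
   fun h X => ⟨le_antisymm (h.1 X).1 (h.2 X).1, le_antisymm (h.1 X).2 (h.2 X).2⟩⟩

theorem Le.trans {G H K : WellTemperedGame} (h : Le G H) (h' : Le H K) : Le G K :=
  fun X => ⟨(h X).1.trans (h' X).1, (h X).2.trans (h' X).2⟩

end WellTemperedGame

/-- The partially ordered monoid `W` of well-tempered scoring games modulo equivalence. -/
def GameClass : Type 1 := Quotient WellTemperedGame.setoid

namespace GameClass

open ScoringGame

/-- The equivalence class of a well-tempered game. -/
def mk (G : ScoringGame) (hG : G.WellTempered) : GameClass :=
  Quotient.mk WellTemperedGame.setoid ⟨G, hG⟩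

/-- The order on classes induced by `≲`. -/
instance : PartialOrder GameClass where
  le := Quotient.lift₂ WellTemperedGame.Le fun _ _ _ _ h h' => by
    rw [WellTemperedGame.equiv_iff] at h h'
    exact propext ⟨fun k => h.2.trans (k.trans h'.1), fun k => h.1.trans (k.trans h'.2)⟩
  le_refl := by rintro ⟨G⟩ X; exact ⟨le_rfl, le_rfl⟩
  le_trans := by rintro ⟨G⟩ ⟨H⟩ ⟨K⟩ h h'; exact WellTemperedGame.Le.trans h h'
  le_antisymm := by
    rintro ⟨G⟩ ⟨H⟩ h h'; exact Quotient.sound (WellTemperedGame.equiv_iff.2 ⟨h, h'⟩)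

instance : Zero GameClass := ⟨mk (int 0) (.inl rfl)⟩

/-- The addition on classes induced by the disjunctive sum. -/
instance : Add GameClass :=
  ⟨Quotient.map₂ WellTemperedGame.add fun _ _ h _ _ h' => by
    rw [WellTemperedGame.equiv_iff] at h h' ⊢
    exact ⟨h.1.add h'.1, h.2.add h'.2⟩⟩

instance : AddCommMonoid GameClass where
  add_assoc := by
    rintro ⟨G⟩ ⟨H⟩ ⟨K⟩; exact Quotient.sound fun X => add_assoc_outcome G.1 H.1 K.1 X.1
  add_comm := by rintro ⟨G⟩ ⟨H⟩; exact Quotient.sound fun X => add_comm_outcome G.1 H.1 X.1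
  zero_add := by
    rintro ⟨G⟩
    exact Quotient.sound fun X =>
      ⟨(add_comm_outcome (int 0) G.1 X.1).1.trans (add_zero_outcome G.1 X.1).1,
        (add_comm_outcome (int 0) G.1 X.1).2.trans (add_zero_outcome G.1 X.1).2⟩
  add_zero := by rintro ⟨G⟩; exact Quotient.sound fun X => add_zero_outcome G.1 X.1
  nsmul := nsmulRec

instance : IsOrderedAddMonoid GameClass where
  add_le_add_left := by
    rintro ⟨G⟩ ⟨H⟩ h ⟨K⟩; exact WellTemperedGame.Le.add h fun _ => ⟨le_rfl, le_rfl⟩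

theorem mk_add_neg {G : ScoringGame} (hG : G.InI) : mk (G.neg.add G) (hG.1.neg.add hG.1) = 0 := by
  refine Quotient.sound fun X => ?_
  show (add (add G.neg G) X.1).left = (add (int 0) X.1).left ∧
    (add (add G.neg G) X.1).right = (add (int 0) X.1).right
  have c1 := add_comm_outcome₂ (add G.neg G) X.1
  have c2 := int_add_outcome 0 X.1
  have c3 := add_comm_outcome₂ G G.neg
  have m := mirror G
  have hi := gap_zero_eq_zero_iff.1 (hG.neg.add hG).2
  have hp : (add G.neg G).IsEven := by
    rcases hG.1 with p | p
    · exact p.neg.add p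
    · exact p.neg.add p
  have lo := (outcome_lower (add G.neg G) X.1 hi).1 hp
  have up := (outcome_upper (add G.neg G) X.1 hi).1 hp
  omega

end GameClass

/-- The set `I⁰` of the classes of the even-tempered games in `I`, with the addition and the order
of `W`. -/
def evenInvertible : AddSubmonoid GameClass where
  carrier := {x | ∃ (G : ScoringGame) (hG : G.InI), G.IsEven ∧ x = GameClass.mk G hG.1}
  add_mem' := by
    rintro _ _ ⟨G, hG, p, rfl⟩ ⟨H, hH, q, rfl⟩
    exact ⟨G.add H, hG.add hH, p.add q, rfl⟩
  zero_mem' := by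
    refine ⟨.int 0, ⟨.inl rfl, ScoringGame.gap_zero_eq_zero_iff.2 ?_⟩, rfl, rfl⟩
    intro H h _
    cases h with
    | refl => exact le_rfl
    | left hl _ => exact hl.elim
    | right hr _ => exact hr.elim

namespace evenInvertible

/-- The class in `I⁰` of an even-tempered game in `I`. -/
def mk (G : ScoringGame) (hI : G.InI) (hG : G.IsEven) : evenInvertible :=
  ⟨GameClass.mk G hI.1, G, hI, hG, rfl⟩

theorem exists_neg (x : evenInvertible) : ∃ y : evenInvertible, y + x = 0 := by
  obtain ⟨_, G, hI, hG, rfl⟩ := x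
  exact ⟨mk G.neg hI.neg hG.neg, Subtype.ext (GameClass.mk_add_neg hI)⟩

instance : Neg evenInvertible := ⟨fun x => (exists_neg x).choose⟩

instance : AddCommGroup evenInvertible where
  neg_add_cancel x := (exists_neg x).choose_spec
  zsmul := zsmulRec

end evenInvertible

end

noncomputable section

-- The bridge between scores and normal play is `psi_compare_int`. Suppose every even-tempered
-- subgame of G satisfies R ≤ L and every odd-tempered one R ≤ L + 2. Then ψ(G) compares with
-- integers as the outcomes do: for even G, n ≤ ψ(G) iff n ≤ R(G), and ψ(G) ≤ n iff L(G) ≤ n; for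
-- odd G the inequalities on outcomes become strict. The gap bounds leave room for at most one
-- integer between the options of {ψ(G^L) | ψ(G^R)}, so the simplicity rule cannot pick an integer
-- other than the one predicted by the outcomes.
--
-- It follows that a non-integer G in this class has a left option l with ψ(G) ≤ ψ(l) + 1, and
-- dually on the right. The moves that an integer has in normal play, but not as a scoring game, are
-- therefore dominated by moves in the other summand, and ψ is additive (`psi_add`). Since ψ(-G) =
-- -ψ(G), for even games ψ(G) ≤ ψ(H) iff R(H - G) ≥ 0. The same inequality decides G ≲ H in I⁰
-- (`evenInvertible.mk_le_mk_iff`), so ψ induces an order embedding of the even part of J.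
--
-- Statement (1) is an induction (`psi_heat_one`). Heating by 1 changes each move by ±1. If the
-- options are odd, the inductive hypothesis supplies a further *, and ±1 becomes ±(1*). If they are
-- even, the outer * cancels the star of 1*, and the additional move from * to 0 is dominated by the
-- inequality above.
--
-- For (2), heating by n is additive, preserves the outcomes of even games and lowers odd gaps by
-- 2n. So ψ∘∫^n embeds the even part of F_{n+1} in Pg, and by (1) the embeddings for n and n + 1
-- differ by the overheating map. The classes F_n exhaust I because games are finite. Conversely,
-- every value is ψ of an even game in J (`exists_psi_eq`), and cooling that game by n gives a
-- member of F_{n+1}; hence the map to the limit is onto.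

namespace PartizanGame

-- Integers, star and overheating in the group of partizan games.

theorem neg_zero : neg zero = zero := by
  show mk Empty Empty _ _ = mk Empty Empty _ _
  congr 1 <;> exact Subsingleton.elim _ _

theorem isLeft_ofInt {l : PartizanGame} {n : ℤ} :
    IsLeft l (ofInt n) ↔ 0 < n ∧ l = ofInt (n - 1) := by
  rcases n with (_ | n) | n
  · exact ⟨fun h => (not_isLeft_zero _ h).elim, fun h => absurd h.1 (by decide)⟩
  · have e : (Int.ofNat (n + 1) - 1 : ℤ) = Int.ofNat n := by simp
    rw [e]
    exact ⟨fun ⟨_, h⟩ => ⟨by simp, h.symm⟩, fun h => ⟨(), h.2.symm⟩⟩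
  · exact ⟨fun h => (by obtain ⟨⟨⟩, -⟩ := h), fun h => by have := h.1; omega⟩

theorem isRight_ofInt {r : PartizanGame} {n : ℤ} :
    IsRight r (ofInt n) ↔ n < 0 ∧ r = ofInt (n + 1) := by
  rcases n with (_ | n) | (_ | n)
  · exact ⟨fun h => (not_isRight_zero _ h).elim, fun h => absurd h.1 (by decide)⟩
  · exact ⟨fun ⟨i, _⟩ => i.elim, fun h => by have := h.1; simp at this; omega⟩
  · have e : neg zero = ofInt (Int.negSucc 0 + 1) := neg_zero
    rw [← e]
    exact ⟨fun ⟨_, h⟩ => ⟨by decide, h.symm⟩, fun h => ⟨(), h.2.symm⟩⟩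
  · exact ⟨fun ⟨_, h⟩ => ⟨by omega, h.symm⟩, fun h => ⟨(), h.2.symm⟩⟩

end PartizanGame

namespace Pg

open PartizanGame

theorem mk_surjective (x : Pg) : ∃ y, x = mk y := Quotient.exists_rep x |>.imp fun _ h => h.symm

theorem mk_le_mk_iff {x y : PartizanGame} : mk x ≤ mk y ↔
    (∀ l, IsLeft l x → ¬ mk y ≤ mk l) ∧ ∀ r, IsRight r y → ¬ mk r ≤ mk x := by
  rw [mk_le_mk, le_iff]
  simp only [mk_le_mk, PartizanGame.not_le]

theorem not_le_of_isLeft {l x : PartizanGame} (h : IsLeft l x) : ¬ mk x ≤ mk l :=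
  (mk_le_mk_iff.1 le_rfl).1 l h

theorem not_le_of_isRight {r x : PartizanGame} (h : IsRight r x) : ¬ mk r ≤ mk x :=
  (mk_le_mk_iff.1 le_rfl).2 r h

/-- The value of an integer. -/
def ofInt (n : ℤ) : Pg := mk (PartizanGame.ofInt n)

/-- Every left move of the sum n + 1 leads to the value n, either by playing in the summand 1 or by
induction, so the sum agrees with the form {n | }. This makes the recursively defined integer forms
multiples of the form 1. -/
theorem ofInt_natCast_succ (n : ℕ) : ofInt (n + 1 : ℕ) = ofInt n + ofInt 1 := by
  induction n with
  | zero => exact (zero_add (ofInt 1)).symm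
  | succ n ih =>
    have noR : ∀ (k : ℕ) r, ¬ IsRight r (PartizanGame.ofInt k) := fun k r h => by
      have := (isRight_ofInt.1 h).1
      omega
    refine le_antisymm (mk_le_mk_iff.2 ⟨fun l hl => ?_, fun r hr => ?_⟩)
      (mk_le_mk_iff.2 ⟨fun l hl => ?_, fun r hr => (noR _ r hr).elim⟩)
    · obtain ⟨-, rfl⟩ := isLeft_ofInt.1 hl
      rw [show ((n + 1 + 1 : ℕ) : ℤ) - 1 = (n + 1 : ℕ) by push_cast; ring]
      have h := not_le_of_isLeft (isLeft_add.2 (.inr ⟨_,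
        (isLeft_ofInt (n := 1)).2 ⟨by decide, rfl⟩, rfl⟩) :
        IsLeft _ (add (PartizanGame.ofInt (n + 1 : ℕ)) (PartizanGame.ofInt 1)))
      rwa [mk_add _ (PartizanGame.ofInt (1 - 1)), show mk (PartizanGame.ofInt (1 - 1)) = 0 from rfl,
        add_zero] at h
    · rcases isRight_add.1 hr with ⟨r, hr, -⟩ | ⟨r, hr, -⟩
      · exact (noR _ r hr).elim
      · exact (noR 1 r hr).elim
    · have h : ¬ mk (PartizanGame.ofInt (n + 1 + 1 : ℕ)) ≤ mk (PartizanGame.ofInt (n + 1 : ℕ)) :=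
        not_le_of_isLeft (isLeft_ofInt.2 ⟨by omega, congrArg _ (by push_cast; ring)⟩)
      rcases isLeft_add.1 hl with ⟨l, hl', rfl⟩ | ⟨l, hl', rfl⟩
      · obtain ⟨-, rfl⟩ := isLeft_ofInt.1 hl'
        rw [mk_add, show ((n + 1 : ℕ) : ℤ) - 1 = n by push_cast; ring]
        exact fun k => h (k.trans ih.ge)
      · obtain ⟨-, rfl⟩ := isLeft_ofInt.1 hl'
        rw [mk_add, show mk (PartizanGame.ofInt (1 - 1)) = 0 from rfl, add_zero]
        exact h

theorem ofInt_eq_zsmul (n : ℤ) : ofInt n = n • ofInt 1 := by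
  have h : ∀ n : ℕ, ofInt n = n • ofInt 1 := fun n => by
    induction n with
    | zero => exact (zero_smul ℕ (ofInt 1)).symm
    | succ n ih => rw [ofInt_natCast_succ, ih, succ_nsmul]
  rcases n with n | n
  · exact (h n).trans (natCast_zsmul _ _).symm
  · rw [negSucc_zsmul, ← h]
    rfl

theorem ofInt_add (m n : ℤ) : ofInt (m + n) = ofInt m + ofInt n := by
  simp only [ofInt_eq_zsmul (m + n), ofInt_eq_zsmul m, ofInt_eq_zsmul n, add_zsmul]

theorem ofInt_neg (n : ℤ) : ofInt (-n) = -ofInt n := by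
  rw [ofInt_eq_zsmul, ofInt_eq_zsmul n, neg_zsmul]

theorem ofInt_one_pos : 0 < ofInt 1 := by
  have h : IsLeft zero (PartizanGame.ofInt 1) := isLeft_ofInt.2 ⟨by decide, rfl⟩
  refine lt_of_le_not_ge (mk_le_mk_iff.2 ⟨fun l hl => (not_isLeft_zero _ hl).elim, fun r hr => ?_⟩)
    (not_le_of_isLeft h)
  exact absurd (isRight_ofInt.1 hr).1 (by decide)

theorem ofInt_le_ofInt {m n : ℤ} : ofInt m ≤ ofInt n ↔ m ≤ n := by
  rw [ofInt_eq_zsmul, ofInt_eq_zsmul n]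
  exact (zsmul_left_strictMono ofInt_one_pos).le_iff_le

/-- An integer lying strictly between the left and the right options forces the value to be an
integer. -/
theorem exists_eq_ofInt {x : PartizanGame}
    (h : ∃ n : ℤ, (∀ l, IsLeft l x → ¬ ofInt n ≤ mk l) ∧ ∀ r, IsRight r x → ¬ mk r ≤ ofInt n) :
    ∃ m, mk x = ofInt m := by
  classical
  have h' : ∃ k : ℕ, ∃ n : ℤ, n.natAbs = k ∧ (∀ l, IsLeft l x → ¬ ofInt n ≤ mk l) ∧
      ∀ r, IsRight r x → ¬ mk r ≤ ofInt n := by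
    obtain ⟨n, hn⟩ := h
    exact ⟨_, n, rfl, hn⟩
  obtain ⟨n, hn, hl, hr⟩ := Nat.find_spec h'
  have hmin : ∀ m : ℤ, m.natAbs < n.natAbs → ¬ ((∀ l, IsLeft l x → ¬ ofInt m ≤ mk l) ∧
      ∀ r, IsRight r x → ¬ mk r ≤ ofInt m) := fun m hm k =>
    Nat.find_min h' (hn ▸ hm) ⟨m, rfl, k⟩
  -- Here n has least absolute value among the fitting integers. The only option of the form n is
  -- its neighbour nearer to zero; if that option spoiled equality, it would fit as well, against
  -- minimality.
  refine ⟨n, le_antisymm (mk_le_mk_iff.2 ⟨hl, fun r hr' k => ?_⟩)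
    (mk_le_mk_iff.2 ⟨fun l hl' k => ?_, hr⟩)⟩
  · obtain ⟨h0, rfl⟩ := isRight_ofInt.1 hr'
    refine hmin (n + 1) (by omega) ⟨fun l h j => ?_, fun r h j => ?_⟩
    · exact hl l h ((ofInt_le_ofInt.2 (by omega)).trans j)
    · exact not_le_of_isRight h (j.trans k)
  · obtain ⟨h0, rfl⟩ := isLeft_ofInt.1 hl'
    refine hmin (n - 1) (by omega) ⟨fun l h j => ?_, fun r h j => ?_⟩
    · exact not_le_of_isLeft h (k.trans j)
    · exact hr r h (j.trans (ofInt_le_ofInt.2 (by omega)))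

theorem star_add_star : star + star = 0 := by
  have e : PartizanGame.neg PartizanGame.star = PartizanGame.star := by
    simp only [PartizanGame.star, PartizanGame.neg, PartizanGame.neg_zero]
  have h := add_neg_cancel star
  rwa [star, ← mk_neg, e] at h

theorem neg_star : -star = star := neg_eq_of_add_eq_zero_left star_add_star

theorem isLeft_star {l : PartizanGame} : IsLeft l PartizanGame.star ↔ l = zero :=
  ⟨fun ⟨_, h⟩ => h.symm, fun h => ⟨(), h.symm⟩⟩

theorem isRight_star {l : PartizanGame} : IsRight l PartizanGame.star ↔ l = zero :=
  ⟨fun ⟨_, h⟩ => h.symm, fun h => ⟨(), h.symm⟩⟩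

/-- By additivity only n = 1 matters, and its overheating is {1* | }. This equals 1, because 1 ≤ 1*
fails while 0 ≤ 1* holds: 1 is the first integer not excluded by the left option. -/
theorem overheat_ofInt (n : ℤ) : overheat (ofInt n) = ofInt n := by
  rw [ofInt_eq_zsmul, map_zsmul]
  congr 1
  have hl : ∀ l, IsLeft l (PartizanGame.overheat
      (PartizanGame.add (PartizanGame.ofInt 1) PartizanGame.star) (PartizanGame.ofInt 1)) →
      mk l = ofInt 1 + star := fun l hl => by
    obtain ⟨l, h, rfl⟩ := isLeft_overheat.1 hl
    obtain ⟨-, rfl⟩ := isLeft_ofInt.1 h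
    exact (congrArg (· + (ofInt 1 + star)) (map_zero overheat)).trans (zero_add _)
  refine le_antisymm (mk_le_mk_iff.2 ⟨fun l h k => ?_, fun r hr => ?_⟩)
    (mk_le_mk_iff.2 ⟨fun l h k => ?_, fun r hr => ?_⟩)
  · rw [hl l h] at k
    exact not_le_of_isRight (isRight_add.2 (.inr ⟨_, isRight_star.2 rfl, rfl⟩) :
      IsRight _ (add (PartizanGame.ofInt 1) PartizanGame.star))
      ((add_zero (ofInt 1)).le.trans k)
  · exact absurd (isRight_ofInt.1 hr).1 (by decide)
  · obtain ⟨-, rfl⟩ := isLeft_ofInt.1 h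
    have h1 := not_le_of_isLeft (isLeft_overheat.2 ⟨_,
      (isLeft_ofInt (n := 1)).2 ⟨by decide, rfl⟩, rfl⟩ : IsLeft _ (PartizanGame.overheat
      (PartizanGame.add (PartizanGame.ofInt 1) PartizanGame.star) (PartizanGame.ofInt 1)))
    refine h1 (k.trans ?_)
    rw [hl _ (isLeft_overheat.2 ⟨_, (isLeft_ofInt (n := 1)).2 ⟨by decide, rfl⟩, rfl⟩)]
    refine mk_le_mk_iff.2 ⟨fun l hl => absurd (isLeft_ofInt.1 hl).1 (by decide), fun r hr k => ?_⟩
    rcases isRight_add.1 hr with ⟨r, h, rfl⟩ | ⟨r, h, rfl⟩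
    · exact absurd (isRight_ofInt.1 h).1 (by decide)
    · rw [isRight_star.1 h] at k
      exact ofInt_one_pos.not_ge ((add_zero (ofInt 1)).ge.trans k)
  · obtain ⟨r, h, rfl⟩ := isRight_overheat.1 hr
    exact absurd (isRight_ofInt.1 h).1 (by decide)

end Pg

-- Gap bounds as inequalities at every subgame.

namespace ScoringGame

/-- Every even-tempered subgame satisfies `R ≤ L`, every odd-tempered one `R ≤ L + 2c`. -/
def GapBound (c : ℤ) (G : ScoringGame) : Prop := ∀ H, Subgame H G →
  (H.IsEven → H.right ≤ H.left) ∧ (H.IsOdd → H.right ≤ H.left + 2 * c)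

theorem GapBound.of_isLeft {c : ℤ} {G l : ScoringGame} (hG : GapBound c G) (h : IsLeft l G) :
    GapBound c l := fun H hH => hG H (.left h hH)

theorem GapBound.of_isRight {c : ℤ} {G r : ScoringGame} (hG : GapBound c G) (h : IsRight r G) :
    GapBound c r := fun H hH => hG H (.right h hH)

theorem GapBound.mono {c d : ℤ} {G : ScoringGame} (hG : GapBound c G) (h : c ≤ d) :
    GapBound d G := fun H hH =>
  ⟨(hG H hH).1, fun p => ((hG H hH).2 p).trans (by omega)⟩

theorem gapBound_of {c : ℤ} {G : ScoringGame}
    (h : (G.IsEven → G.right ≤ G.left) ∧ (G.IsOdd → G.right ≤ G.left + 2 * c))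
    (hl : ∀ l, IsLeft l G → GapBound c l) (hr : ∀ r, IsRight r G → GapBound c r) :
    GapBound c G := fun H hH => by
  cases hH with
  | refl => exact h
  | left k hH => exact hl _ k H hH
  | right k hH => exact hr _ k H hH

theorem gapBound_int (c n : ℤ) : GapBound c (int n) :=
  gapBound_of ⟨fun _ => le_rfl, fun h => (not_isOdd_int h).elim⟩ (fun _ h => h.elim)
    fun _ h => h.elim

/-- This trades suprema in the extended reals for integer inequalities that can be proved by
induction on options. The equality gap₀ = 0 reduces to an upper bound because an integer subgame
already contributes 0. -/
theorem inF_iff {n : ℕ} {G : ScoringGame} : G.InF n ↔ G.WellTempered ∧ GapBound n G := by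
  rw [InF, InI, gap_zero_eq_zero_iff, and_assoc]
  have h : G.gap 1 ≤ 2 * n ↔ ∀ H, Subgame H G → H.IsOdd → H.right ≤ H.left + 2 * n := by
    simp only [gap, iSup_le_iff, IsOdd]
    refine forall₃_congr fun H _ _ => ?_
    rw [← sub_le_iff_le_add']
    have e : (2 * n : EReal) = ((2 * n : ℤ) : ℝ) := by push_cast; norm_cast
    rw [e]
    norm_cast
  rw [h]
  exact and_congr_right fun _ => ⟨fun h H hH => ⟨h.1 H hH, h.2 H hH⟩,
    fun h => ⟨fun H hH => (h H hH).1, fun H hH => (h H hH).2⟩⟩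

theorem inJ_iff {G : ScoringGame} : G.InJ ↔ G.WellTempered ∧ GapBound 1 G := by
  have h := inF_iff (n := 1) (G := G)
  rwa [InF, Nat.cast_one, mul_one] at h

/-! ### Translation by integers and heating -/

theorem isLeft_int_add {a : ℤ} {l G : ScoringGame} :
    IsLeft l (add (int a) G) ↔ ∃ l', IsLeft l' G ∧ l = add (int a) l' := by
  rw [isLeft_add]
  exact ⟨fun h => h.resolve_left fun ⟨_, h, _⟩ => h, .inr⟩

theorem isRight_int_add {a : ℤ} {r G : ScoringGame} :
    IsRight r (add (int a) G) ↔ ∃ r', IsRight r' G ∧ r = add (int a) r' := by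
  rw [isRight_add]
  exact ⟨fun h => h.resolve_left fun ⟨_, h, _⟩ => h, .inr⟩

theorem isLeft_heat {t : ℤ} {l G : ScoringGame} :
    IsLeft l (heat t G) ↔ ∃ l', IsLeft l' G ∧ l = add (int t) (heat t l') := by
  cases G <;>
  simp only [heat, IsLeft, exists_exists_eq_and, eq_comm (a := l), false_and, exists_false]

theorem isRight_heat {t : ℤ} {r G : ScoringGame} :
    IsRight r (heat t G) ↔ ∃ r', IsRight r' G ∧ r = add (int (-t)) (heat t r') := by
  cases G <;>
  simp only [heat, IsRight, exists_exists_eq_and, eq_comm (a := r), false_and, exists_false]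

/-- This identity and the following ones hold between forms and not merely up to equivalence, so
they can be used inside `psi`, `GapBound` and `Subgame`, all of which are defined on forms. -/
theorem zero_add (G : ScoringGame) : add (int 0) G = G := by
  induction G with
  | int n => rw [int_add_int, _root_.zero_add]
  | node α β L R ihL ihR => simp only [int_add_node, ihL, ihR]

theorem int_add_add (a : ℤ) (G H : ScoringGame) :
    add (int a) (add G H) = add (add (int a) G) H := by
  induction G generalizing H with
  | int n =>
    induction H with
    | int m => simp only [int_add_int, _root_.add_assoc]
    | node α β L R ihL ihR =>
      simp only [int_add_int, int_add_node] at *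
      simp only [ihL, ihR]
  | node α β L R ihL ihR =>
    induction H with
    | int m => simp only [node_add_int, int_add_node, ihL, ihR]
    | node α' β' L' R' ihL' ihR' =>
      simp only [int_add_node, node_add_node] at *
      congr 1 <;> (funext i; cases i) <;> simp only [Sum.elim_inl, Sum.elim_inr, ihL, ihR, ihL', ihR']

theorem add_int_add (a : ℤ) (G H : ScoringGame) :
    add G (add (int a) H) = add (int a) (add G H) := by
  induction G generalizing H with
  | int n => rw [int_add_add, int_add_add, int_add_int, int_add_int, add_comm]
  | node α β L R ihL ihR =>
    induction H with
    | int m =>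
      rw [int_add_int, node_add_int, node_add_int, int_add_node]
      congr 1 <;> funext i
      · rw [← ihL, int_add_int]
      · rw [← ihR, int_add_int]
    | node α' β' L' R' ihL' ihR' =>
      simp only [int_add_node, node_add_node] at *
      congr 1 <;> (funext i; cases i) <;>
        simp only [Sum.elim_inl, Sum.elim_inr, ← ihL, ← ihR, ihL', ihR', int_add_node]

theorem heat_int_add (t a : ℤ) (G : ScoringGame) :
    heat t (add (int a) G) = add (int a) (heat t G) := by
  induction G with
  | int n => rfl
  | node α β L R ihL ihR => simp only [int_add_node, heat, ihL, ihR, add_int_add _ (int a)]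

/-- Temperatures may be negative, so together with `heat_zero` this lets cooling by t undo heating
by t exactly. -/
theorem heat_heat (s t : ℤ) (G : ScoringGame) : heat s (heat t G) = heat (s + t) G := by
  induction G with
  | int n => rfl
  | node α β L R ihL ihR =>
    simp only [heat, heat_int_add, ihL, ihR, int_add_add, int_add_int, neg_add]

theorem heat_zero (G : ScoringGame) : heat 0 G = G := by
  induction G with
  | int n => rfl
  | node α β L R ihL ihR => simp only [heat, ihL, ihR, neg_zero, zero_add]

/-- A move in a sum is a move in exactly one summand, so it receives the bonus exactly once on
either side. -/
theorem heat_add (t : ℤ) (G H : ScoringGame) : heat t (add G H) = add (heat t G) (heat t H) := by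
  induction G generalizing H with
  | int n => exact heat_int_add t n H
  | node α β L R ihL ihR =>
    induction H with
    | int m => simp only [node_add_int, heat, ihL, ihR, int_add_add]
    | node α' β' L' R' ihL' ihR' =>
      simp only [node_add_node, heat] at *
      congr 1 <;> (funext i; cases i) <;>
        simp only [Sum.elim_inl, Sum.elim_inr, ihL, ihR, ihL', ihR', int_add_add, add_int_add, heat]

theorem neg_int_add (a : ℤ) (G : ScoringGame) :
    neg (add (int a) G) = add (int (-a)) (neg G) := by
  induction G with
  | int n => simp only [int_add_int, neg, neg_add]
  | node α β L R ihL ihR => simp only [int_add_node, neg, ihL, ihR]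

theorem heat_neg (t : ℤ) (G : ScoringGame) : heat t (neg G) = neg (heat t G) := by
  induction G with
  | int n => rfl
  | node α β L R ihL ihR => simp only [heat, neg, ihL, ihR, neg_int_add, neg_neg]

theorem HasParity.int_add {G : ScoringGame} {p : ZMod 2} (hG : G.HasParity p) (a : ℤ) :
    (ScoringGame.add (int a) G).HasParity p := by
  have h := HasParity.add (G := int a) (p := 0) rfl hG
  rwa [_root_.zero_add] at h

theorem HasParity.heat {G : ScoringGame} {p : ZMod 2} (hG : G.HasParity p) (t : ℤ) :
    (heat t G).HasParity p := by
  induction G generalizing p with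
  | int n => exact hG
  | node α β L R ihL ihR =>
    exact ⟨fun i => (ihL i (hG.1 i)).int_add _, fun j => (ihR j (hG.2 j)).int_add _⟩

theorem IsEven.of_isLeft {G l : ScoringGame} (hG : G.IsEven) (h : IsLeft l G) : l.IsOdd :=
  HasParity.of_isLeft hG h

theorem IsEven.of_isRight {G r : ScoringGame} (hG : G.IsEven) (h : IsRight r G) : r.IsOdd :=
  HasParity.of_isRight hG h

theorem IsOdd.of_isLeft {G l : ScoringGame} (hG : G.IsOdd) (h : IsLeft l G) : l.IsEven :=
  HasParity.of_isLeft hG h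

theorem IsOdd.of_isRight {G r : ScoringGame} (hG : G.IsOdd) (h : IsRight r G) : r.IsEven :=
  HasParity.of_isRight hG h

theorem left_eq_of {l G : ScoringGame} {x : ℤ} (hl : IsLeft l G)
    (h : ∀ l, IsLeft l G → l.right ≤ x) (h' : ∃ l, IsLeft l G ∧ l.right = x) : G.left = x := by
  obtain ⟨k, hk, e⟩ := exists_left hl
  obtain ⟨k', hk', rfl⟩ := h'
  exact le_antisymm (e ▸ h k hk) (right_le_left hk')

theorem right_eq_of {r G : ScoringGame} {x : ℤ} (hr : IsRight r G)
    (h : ∀ r, IsRight r G → x ≤ r.left) (h' : ∃ r, IsRight r G ∧ r.left = x) : G.right = x := by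
  obtain ⟨k, hk, e⟩ := exists_right hr
  obtain ⟨k', hk', rfl⟩ := h'
  exact le_antisymm (right_le_left' hk') (e ▸ h k hk)

/-- The players alternate. In an even game both make the same number of moves and the bonuses
cancel; in an odd game the first player makes one move more and gains t. -/
theorem heat_outcome (t : ℤ) (G : ScoringGame) :
    (G.IsEven → (heat t G).left = G.left ∧ (heat t G).right = G.right) ∧
      (G.IsOdd → (heat t G).left = G.left + t ∧ (heat t G).right = G.right - t) := by
  induction G using opt_induction with
  | h G Gl Gr =>
    rcases int_or G with ⟨n, rfl⟩ | ⟨⟨l, hl⟩, ⟨r, hr⟩⟩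
    · exact ⟨fun _ => ⟨rfl, rfl⟩, fun h => (not_isOdd_int h).elim⟩
    · obtain ⟨l', hl', el⟩ := exists_left hl
      obtain ⟨r', hr', er⟩ := exists_right hr
      have ml : IsLeft _ (heat t G) := isLeft_heat.2 ⟨l', hl', rfl⟩
      have mr : IsRight _ (heat t G) := isRight_heat.2 ⟨r', hr', rfl⟩
      refine ⟨fun p => ⟨left_eq_of ml (fun k hk => ?_) ⟨_, ml, ?_⟩,
        right_eq_of mr (fun k hk => ?_) ⟨_, mr, ?_⟩⟩,
        fun p => ⟨left_eq_of ml (fun k hk => ?_) ⟨_, ml, ?_⟩,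
        right_eq_of mr (fun k hk => ?_) ⟨_, mr, ?_⟩⟩⟩
      · obtain ⟨k, hk', rfl⟩ := isLeft_heat.1 hk
        rw [(int_add_outcome _ _).2, ((Gl k hk').2 (p.of_isLeft hk')).2]
        have := right_le_left hk'
        omega
      · rw [(int_add_outcome _ _).2, ((Gl _ hl').2 (p.of_isLeft hl')).2]
        omega
      · obtain ⟨k, hk', rfl⟩ := isRight_heat.1 hk
        rw [(int_add_outcome _ _).1, ((Gr k hk').2 (p.of_isRight hk')).1]
        have := right_le_left' hk'
        omega
      · rw [(int_add_outcome _ _).1, ((Gr _ hr').2 (p.of_isRight hr')).1]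
        omega
      · obtain ⟨k, hk', rfl⟩ := isLeft_heat.1 hk
        rw [(int_add_outcome _ _).2, ((Gl k hk').1 (p.of_isLeft hk')).2]
        have := right_le_left hk'
        omega
      · rw [(int_add_outcome _ _).2, ((Gl _ hl').1 (p.of_isLeft hl')).2]
        omega
      · obtain ⟨k, hk', rfl⟩ := isRight_heat.1 hk
        rw [(int_add_outcome _ _).1, ((Gr k hk').1 (p.of_isRight hk')).1]
        have := right_le_left' hk'
        omega
      · rw [(int_add_outcome _ _).1, ((Gr _ hr').1 (p.of_isRight hr')).1]
        omega

/-! ### Closure properties of the gap bounds -/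

theorem IsEven.not_isOdd {G : ScoringGame} (h : G.IsEven) : ¬ G.IsOdd := fun h' =>
  absurd (HasParity.unique h h') (by decide)

/-- Suited to operations that preserve parity: the inequality required of the new game H is indexed
by the parity of the old game G, about which the hypotheses speak. -/
theorem gapBound_of_parity {c : ℤ} {p : ZMod 2} {G H : ScoringGame} (hG : G.HasParity p)
    (hH : H.HasParity p) (h : (G.IsEven → H.right ≤ H.left) ∧ (G.IsOdd → H.right ≤ H.left + 2 * c))
    (hl : ∀ l, IsLeft l H → GapBound c l) (hr : ∀ r, IsRight r H → GapBound c r) :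
    GapBound c H :=
  gapBound_of ⟨fun q => h.1 (by rw [IsEven, ← HasParity.unique hH q]; exact hG),
    fun q => h.2 (by rw [IsOdd, ← HasParity.unique hH q]; exact hG)⟩ hl hr

theorem GapBound.int_add {c : ℤ} {G : ScoringGame} {p : ZMod 2} (hp : G.HasParity p)
    (hG : GapBound c G) (a : ℤ) : GapBound c (add (int a) G) := by
  induction G using opt_induction generalizing p with
  | h G Gl Gr =>
    refine gapBound_of_parity hp (hp.int_add a) ?_ (fun l hl => ?_) fun r hr => ?_
    · rw [(int_add_outcome a G).1, (int_add_outcome a G).2]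
      have := hG G .refl
      exact ⟨fun q => by have := this.1 q; omega, fun q => by have := this.2 q; omega⟩
    · obtain ⟨l, hl', rfl⟩ := isLeft_int_add.1 hl
      exact Gl l hl' (hp.of_isLeft hl') (hG.of_isLeft hl')
    · obtain ⟨r, hr', rfl⟩ := isRight_int_add.1 hr
      exact Gr r hr' (hp.of_isRight hr') (hG.of_isRight hr')

/-- In an odd subgame L rises by t and R falls by t, so the gap drops by 2t; even subgames keep
their outcomes. -/
theorem GapBound.heat {c : ℤ} {G : ScoringGame} {p : ZMod 2} (hp : G.HasParity p)
    (hG : GapBound c G) (t : ℤ) : GapBound (c - t) (heat t G) := by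
  induction G using opt_induction generalizing p with
  | h G Gl Gr =>
    refine gapBound_of_parity hp (hp.heat t) ?_ (fun l hl => ?_) fun r hr => ?_
    · have := heat_outcome t G
      exact ⟨fun q => by have := this.1 q; have := (hG G .refl).1 q; omega,
        fun q => by have := this.2 q; have := (hG G .refl).2 q; omega⟩
    · obtain ⟨l, hl', rfl⟩ := isLeft_heat.1 hl
      exact (Gl l hl' (hp.of_isLeft hl') (hG.of_isLeft hl')).int_add ((hp.of_isLeft hl').heat t) t
    · obtain ⟨r, hr', rfl⟩ := isRight_heat.1 hr
      exact (Gr r hr' (hp.of_isRight hr') (hG.of_isRight hr')).int_add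
        ((hp.of_isRight hr').heat t) (-t)

theorem GapBound.neg {c : ℤ} {G : ScoringGame} {p : ZMod 2} (hp : G.HasParity p)
    (hG : GapBound c G) : GapBound c (neg G) := by
  induction G using opt_induction generalizing p with
  | h G Gl Gr =>
    refine gapBound_of_parity hp hp.neg ?_ (fun l hl => ?_) fun r hr => ?_
    · rw [(neg_outcome G).1, (neg_outcome G).2]
      have := hG G .refl
      exact ⟨fun q => by have := this.1 q; omega, fun q => by have := this.2 q; omega⟩
    · obtain ⟨l, hl', rfl⟩ := isLeft_neg.1 hl
      exact Gr l hl' (hp.of_isRight hl') (hG.of_isRight hl')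
    · obtain ⟨r, hr', rfl⟩ := isRight_neg.1 hr
      exact Gl r hr' (hp.of_isLeft hr') (hG.of_isLeft hr')

/-- Left answers in the component where Right has just moved. If that component has become an
integer, no answer is available there, but R ≤ L in the other component ensures that Left loses
nothing by moving there instead. The three inequalities need one another, hence the simultaneous
induction; no parity enters. -/
theorem outcome_lower_of_right_le_left (G H : ScoringGame)
    (hG : ∀ K, Subgame K G → K.right ≤ K.left) (hH : ∀ K, Subgame K H → K.right ≤ K.left) :
    G.right + H.right ≤ (add G H).right ∧ G.left + H.right ≤ (add G H).left ∧
      G.right + H.left ≤ (add G H).left := by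
  induction H using opt_induction generalizing G with
  | h H Hl Hr =>
    induction G using opt_induction with
    | h G Gl Gr =>
      refine ⟨?_, ?_, ?_⟩
      · rcases int_or (add G H) with ⟨n, hn⟩ | ⟨-, ⟨r, hr⟩⟩
        · obtain ⟨a, b, rfl, rfl, rfl⟩ := add_eq_int.1 hn
          rw [hn, right, right, right]
        · obtain ⟨r, hr, e⟩ := exists_right hr
          rw [e]
          rcases isRight_add.1 hr with ⟨s, hs, rfl⟩ | ⟨s, hs, rfl⟩
          · have := (Gr s hs fun K hK => hG K (.right hs hK)).2.1
            have := right_le_left' hs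
            omega
          · have := (Hr s hs G hG fun K hK => hH K (.right hs hK)).2.2
            have := right_le_left' hs
            omega
      · rcases int_or G with ⟨a, rfl⟩ | ⟨⟨l, hl⟩, -⟩
        · rw [(int_add_outcome a H).1, left]
          have := hH H .refl
          omega
        · obtain ⟨l, hl, e⟩ := exists_left hl
          have := (Gl l hl fun K hK => hG K (.left hl hK)).1
          have := right_le_left (isLeft_add_left H hl)
          omega
      · rcases int_or H with ⟨a, rfl⟩ | ⟨⟨l, hl⟩, -⟩
        · rw [(add_comm_outcome₂ _ _).1, (int_add_outcome a G).1, left]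
          have := hG G .refl
          omega
        · obtain ⟨l, hl, e⟩ := exists_left hl
          have := (Hl l hl G hG fun K hK => hH K (.left hl hK)).1
          have := right_le_left (isLeft_add_right G hl)
          omega

theorem outcome_upper_of_right_le_left (G H : ScoringGame)
    (hG : ∀ K, Subgame K G → K.right ≤ K.left) (hH : ∀ K, Subgame K H → K.right ≤ K.left) :
    (add G H).left ≤ G.left + H.left ∧ (add G H).right ≤ G.right + H.left ∧
      (add G H).right ≤ G.left + H.right := by
  induction H using opt_induction generalizing G with
  | h H Hl Hr =>
    induction G using opt_induction with
    | h G Gl Gr =>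
      refine ⟨?_, ?_, ?_⟩
      · rcases int_or (add G H) with ⟨n, hn⟩ | ⟨⟨l, hl⟩, -⟩
        · obtain ⟨a, b, rfl, rfl, rfl⟩ := add_eq_int.1 hn
          rw [hn, left, left, left]
        · obtain ⟨l, hl, e⟩ := exists_left hl
          rw [e]
          rcases isLeft_add.1 hl with ⟨s, hs, rfl⟩ | ⟨s, hs, rfl⟩
          · have := (Gl s hs fun K hK => hG K (.left hs hK)).2.1
            have := right_le_left hs
            omega
          · have := (Hl s hs G hG fun K hK => hH K (.left hs hK)).2.2
            have := right_le_left hs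
            omega
      · rcases int_or G with ⟨a, rfl⟩ | ⟨-, ⟨r, hr⟩⟩
        · rw [(int_add_outcome a H).2, right]
          have := hH H .refl
          omega
        · obtain ⟨r, hr, e⟩ := exists_right hr
          have := (Gr r hr fun K hK => hG K (.right hr hK)).1
          have := right_le_left' (isRight_add_left H hr)
          omega
      · rcases int_or H with ⟨a, rfl⟩ | ⟨-, ⟨r, hr⟩⟩
        · rw [(add_comm_outcome₂ _ _).2, (int_add_outcome a G).2, right]
          have := hG G .refl
          omega
        · obtain ⟨r, hr, e⟩ := exists_right hr
          have := (Hr r hr G hG fun K hK => hH K (.right hr hK)).1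
          have := right_le_left' (isRight_add_right G hr)
          omega

theorem GapBound.right_le_left {G : ScoringGame} {p : ZMod 2} (hp : G.HasParity p)
    (hG : GapBound 0 G) : ∀ K, Subgame K G → K.right ≤ K.left := fun K hK => by
  rcases hp.of_subgame hK with q | q
  · exact (hG K hK).1 q
  · simpa using (hG K hK).2 q

/-- After heating by c the gap bound is 0, so R ≤ L holds at every subgame regardless of parity.
That condition passes to sums by the outcome inequalities above. Heating commutes with sums, and
cooling by c restores the original games and the bound c. -/
theorem GapBound.add {c : ℤ} {G H : ScoringGame} {p q : ZMod 2} (hp : G.HasParity p)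
    (hq : H.HasParity q) (hG : GapBound c G) (hH : GapBound c H) : GapBound c (add G H) := by
  have h0 : GapBound 0 (ScoringGame.heat c (ScoringGame.add G H)) := by
    have g := (hG.heat hp c)
    have h := (hH.heat hq c)
    rw [sub_self] at g h
    rw [heat_add]
    have g' := g.right_le_left (hp.heat c)
    have h' := h.right_le_left (hq.heat c)
    have key : ∀ K, Subgame K (ScoringGame.add (ScoringGame.heat c G) (ScoringGame.heat c H)) →
        K.right ≤ K.left := fun K hK => by
      obtain ⟨A, B, hA, hB, rfl⟩ := hK.of_add
      have lo := outcome_lower_of_right_le_left A B (fun K k => g' K (k.trans hA))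
        fun K k => h' K (k.trans hB)
      have up := outcome_upper_of_right_le_left A B (fun K k => g' K (k.trans hA))
        fun K k => h' K (k.trans hB)
      omega
    exact fun K hK => ⟨fun _ => key K hK, fun _ => by simpa using key K hK⟩
  have h := h0.heat ((hp.add hq).heat c) (-c)
  rwa [heat_heat, neg_add_cancel, heat_zero, zero_sub, neg_neg] at h

/-- Finitely many upward closed conditions on a natural number can be met simultaneously. -/
theorem exists_forall_of_finite {α : Type} [Finite α] {P : α → ℕ → Prop}
    (hP : ∀ i m n, m ≤ n → P i m → P i n) (h : ∀ i, ∃ n, P i n) : ∃ n, ∀ i, P i n := by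
  choose f hf using h
  obtain ⟨n, hn⟩ := (Set.finite_range f).bddAbove
  exact ⟨n, fun i => hP i _ _ (hn ⟨i, rfl⟩) (hf i)⟩

/-- A finite game has finitely many subgames, so its odd gaps are bounded: the class I is the union
of the classes F_n. -/
theorem InI.exists_gapBound {G : ScoringGame} (hG : G.InI) : ∃ n : ℕ, GapBound n G := by
  induction G with
  | int n => exact ⟨0, gapBound_int _ n⟩
  | node α β L R ihL ihR =>
    have mono : ∀ (G : ScoringGame) (m n : ℕ), m ≤ n → GapBound m G → GapBound n G :=
      fun G m n h k => k.mono (by omega)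
    obtain ⟨a, ha⟩ := exists_forall_of_finite (fun i => mono (L i))
      fun i => ihL i (hG.of_subgame (.left ⟨i, rfl⟩ .refl))
    obtain ⟨b, hb⟩ := exists_forall_of_finite (fun i => mono (R i))
      fun i => ihR i (hG.of_subgame (.right ⟨i, rfl⟩ .refl))
    set G := node α β L R
    refine ⟨a + b + (G.right - G.left).toNat, gapBound_of
      ⟨gap_zero_eq_zero_iff.1 hG.2 G .refl, fun _ => by push_cast; omega⟩ ?_ ?_⟩
    · rintro _ ⟨i, rfl⟩
      exact (ha i).mono (by push_cast; omega)
    · rintro _ ⟨i, rfl⟩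
      exact (hb i).mono (by push_cast; omega)

end ScoringGame

namespace Pg

open PartizanGame

theorem mk_le_mk_of {x y : PartizanGame} (hl : ∀ l, IsLeft l x → ∃ l', IsLeft l' y ∧ mk l ≤ mk l')
    (hr : ∀ r, IsRight r y → ∃ r', IsRight r' x ∧ mk r' ≤ mk r) : mk x ≤ mk y :=
  mk_le_mk_iff.2 ⟨fun l h k => by
      obtain ⟨l', h', j⟩ := hl l h
      exact not_le_of_isLeft h' (k.trans j),
    fun r h k => by
      obtain ⟨r', h', j⟩ := hr r h
      exact not_le_of_isRight h' (j.trans k)⟩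

end Pg

-- Options of ψ(G) and options of G.

namespace ScoringGame

open Pg (ofInt)

theorem isLeft_psiForm {l G : ScoringGame} (h : IsLeft l G) :
    PartizanGame.IsLeft l.psiForm G.psiForm := by
  cases G with
  | int n => exact h.elim
  | node α β L R => obtain ⟨i, rfl⟩ := h; exact ⟨i, rfl⟩

theorem isRight_psiForm {r G : ScoringGame} (h : IsRight r G) :
    PartizanGame.IsRight r.psiForm G.psiForm := by
  cases G with
  | int n => exact h.elim
  | node α β L R => obtain ⟨i, rfl⟩ := h; exact ⟨i, rfl⟩

/-- The second alternative is the only discrepancy between the two theories: an integer has no moves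
as a scoring game, but a nonzero one has a move as a partizan game. Most of the work on ψ consists
in showing that such moves do no harm. -/
theorem exists_of_isLeft_psiForm {x : PartizanGame} {G : ScoringGame}
    (h : PartizanGame.IsLeft x G.psiForm) :
    (∃ l, IsLeft l G ∧ x = l.psiForm) ∨ ∃ n, G = int n ∧ Pg.mk x = ofInt (n - 1) := by
  cases G with
  | int n =>
    obtain ⟨-, rfl⟩ := PartizanGame.isLeft_ofInt.1 h
    exact .inr ⟨n, rfl, rfl⟩
  | node α β L R => obtain ⟨i, rfl⟩ := h; exact .inl ⟨_, ⟨i, rfl⟩, rfl⟩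

theorem exists_of_isRight_psiForm {x : PartizanGame} {G : ScoringGame}
    (h : PartizanGame.IsRight x G.psiForm) :
    (∃ r, IsRight r G ∧ x = r.psiForm) ∨ ∃ n, G = int n ∧ Pg.mk x = ofInt (n + 1) := by
  cases G with
  | int n =>
    obtain ⟨-, rfl⟩ := PartizanGame.isRight_ofInt.1 h
    exact .inr ⟨n, rfl, rfl⟩
  | node α β L R => obtain ⟨i, rfl⟩ := h; exact .inl ⟨_, ⟨i, rfl⟩, rfl⟩

theorem exists_of_isLeft_psiForm' {x : PartizanGame} {l G : ScoringGame} (hl : IsLeft l G)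
    (h : PartizanGame.IsLeft x G.psiForm) : ∃ l, IsLeft l G ∧ x = l.psiForm :=
  (exists_of_isLeft_psiForm h).resolve_right fun ⟨_, e, _⟩ => by subst e; exact hl

theorem exists_of_isRight_psiForm' {x : PartizanGame} {r G : ScoringGame} (hr : IsRight r G)
    (h : PartizanGame.IsRight x G.psiForm) : ∃ r, IsRight r G ∧ x = r.psiForm :=
  (exists_of_isRight_psiForm h).resolve_right fun ⟨_, e, _⟩ => by subst e; exact hr

theorem not_psi_le_of_isLeft {l G : ScoringGame} (h : IsLeft l G) : ¬ G.psi ≤ l.psi :=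
  Pg.not_le_of_isLeft (isLeft_psiForm h)

theorem not_psi_le_of_isRight {r G : ScoringGame} (h : IsRight r G) : ¬ r.psi ≤ G.psi :=
  Pg.not_le_of_isRight (isRight_psiForm h)

/-! ### Comparison of `ψ(G)` with integers -/

/-- The inequality n ≤ ψ(G) could fail in a second way, through the left option n - 1 of n. The
hypothesis excludes this by a left option of G whose value is at least n - 1, and it is needed only
once the condition on right options holds. -/
theorem ofInt_le_psi_iff {r G : ScoringGame} {n : ℤ} (hr : IsRight r G)
    (h : (∀ r, IsRight r G → ¬ r.psi ≤ ofInt n) → ∃ l, IsLeft l G ∧ ofInt (n - 1) ≤ l.psi) :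
    ofInt n ≤ G.psi ↔ ∀ r, IsRight r G → ¬ r.psi ≤ ofInt n := by
  refine ⟨fun k r hr j => not_psi_le_of_isRight hr (j.trans k), fun k =>
    Pg.mk_le_mk_iff.2 ⟨fun x hx j => ?_, fun x hx => ?_⟩⟩
  · obtain ⟨-, rfl⟩ := PartizanGame.isLeft_ofInt.1 hx
    obtain ⟨l, hl, i⟩ := h k
    exact not_psi_le_of_isLeft hl (j.trans i)
  · obtain ⟨r, hr, rfl⟩ := exists_of_isRight_psiForm' hr hx
    exact k r hr

theorem psi_le_ofInt_iff {l G : ScoringGame} {n : ℤ} (hl : IsLeft l G)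
    (h : (∀ l, IsLeft l G → ¬ ofInt n ≤ l.psi) → ∃ r, IsRight r G ∧ r.psi ≤ ofInt (n + 1)) :
    G.psi ≤ ofInt n ↔ ∀ l, IsLeft l G → ¬ ofInt n ≤ l.psi := by
  refine ⟨fun k r hr j => not_psi_le_of_isLeft hr (k.trans j), fun k =>
    Pg.mk_le_mk_iff.2 ⟨fun x hx => ?_, fun x hx j => ?_⟩⟩
  · obtain ⟨l, hl, rfl⟩ := exists_of_isLeft_psiForm' hl hx
    exact k l hl
  · obtain ⟨-, rfl⟩ := PartizanGame.isRight_ofInt.1 hx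
    obtain ⟨r, hr, i⟩ := h k
    exact not_psi_le_of_isRight hr (le_trans i j)

/-- By the two preceding lemmas only the options of the opposite side have to be compared with n.
They have the opposite parity, so by induction strict inequalities become weak ones and conversely,
and their extremal outcome is R(G) or L(G). The gap bound serves only to meet the side conditions of
those lemmas. -/
theorem psi_compare_int (G : ScoringGame) (hG : GapBound 1 G) :
    (G.IsEven → ∀ n, (ofInt n ≤ G.psi ↔ n ≤ G.right) ∧ (G.psi ≤ ofInt n ↔ G.left ≤ n)) ∧
      (G.IsOdd → ∀ n, (ofInt n ≤ G.psi ↔ n < G.right) ∧ (G.psi ≤ ofInt n ↔ G.left < n)) := by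
  induction G using opt_induction with
  | h G Gl Gr =>
    rcases int_or G with ⟨m, rfl⟩ | ⟨⟨l, hl⟩, ⟨r, hr⟩⟩
    · exact ⟨fun _ n => ⟨Pg.ofInt_le_ofInt, Pg.ofInt_le_ofInt⟩, fun h => (not_isOdd_int h).elim⟩
    · obtain ⟨l, hl, el⟩ := exists_left hl
      obtain ⟨r, hr, er⟩ := exists_right hr
      constructor
      · intro p n
        have gap := (hG G .refl).1 p
        have IL := fun l hl => (Gl l hl (hG.of_isLeft hl)).2 (p.of_isLeft hl)
        have IR := fun r hr => (Gr r hr (hG.of_isRight hr)).2 (p.of_isRight hr)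
        have eR : (∀ r, IsRight r G → ¬ r.psi ≤ ofInt n) ↔ n ≤ G.right := by
          refine ⟨fun k => ?_, fun k s hs => ?_⟩
          · have := k r hr
            rw [(IR r hr n).2] at this
            omega
          · rw [(IR s hs n).2]
            have := right_le_left' hs
            omega
        have eL : (∀ l, IsLeft l G → ¬ ofInt n ≤ l.psi) ↔ G.left ≤ n := by
          refine ⟨fun k => ?_, fun k s hs => ?_⟩
          · have := k l hl
            rw [(IL l hl n).1] at this
            omega
          · rw [(IL s hs n).1]
            have := right_le_left hs
            omega
        -- The best left option has R(l) = L(G) ≥ R(G) ≥ n, which exceeds n - 1 as the criterion for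
        -- the odd game l requires.
        rw [ofInt_le_psi_iff hr fun k => ⟨l, hl, (IL l hl _).1.2 (by rw [eR] at k; omega)⟩,
          psi_le_ofInt_iff hl fun k => ⟨r, hr, (IR r hr _).2.2 (by rw [eL] at k; omega)⟩]
        exact ⟨eR, eL⟩
      · intro p n
        have gap := (hG G .refl).2 p
        have IL := fun l hl => (Gl l hl (hG.of_isLeft hl)).1 (p.of_isLeft hl)
        have IR := fun r hr => (Gr r hr (hG.of_isRight hr)).1 (p.of_isRight hr)
        have eR : (∀ r, IsRight r G → ¬ r.psi ≤ ofInt n) ↔ n < G.right := by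
          refine ⟨fun k => ?_, fun k s hs => ?_⟩
          · have := k r hr
            rw [(IR r hr n).2] at this
            omega
          · rw [(IR s hs n).2]
            have := right_le_left' hs
            omega
        have eL : (∀ l, IsLeft l G → ¬ ofInt n ≤ l.psi) ↔ G.left < n := by
          refine ⟨fun k => ?_, fun k s hs => ?_⟩
          · have := k l hl
            rw [(IL l hl n).1] at this
            omega
          · rw [(IL s hs n).1]
            have := right_le_left hs
            omega
        -- Now n < R(G) ≤ L(G) + 2 yields n - 1 ≤ L(G) = R(l), the weak inequality needed for the
        -- even game l. This is where the bound 2 on odd gaps is used, and it is used in full.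
        rw [ofInt_le_psi_iff hr fun k => ⟨l, hl, (IL l hl _).1.2 (by rw [eR] at k; omega)⟩,
          psi_le_ofInt_iff hl fun k => ⟨r, hr, (IR r hr _).2.2 (by rw [eL] at k; omega)⟩]
        exact ⟨eR, eL⟩

/-- An integer can be put between the two sides: it is L(G) if G is even and L(G) + 1 if G is odd,
and the left option attaining L(G) serves as l. In sums, this shows that giving up one point is
never better for Left than a suitable move in G. -/
theorem exists_psi_le_psi_add_one {l G : ScoringGame} (hw : G.WellTempered) (hG : GapBound 1 G)
    (hl : IsLeft l G) : ∃ l, IsLeft l G ∧ G.psi ≤ l.psi + ofInt 1 := by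
  obtain ⟨l, hl, el⟩ := exists_left hl
  refine ⟨l, hl, ?_⟩
  have KG := psi_compare_int G hG
  have Kl := psi_compare_int l (hG.of_isLeft hl)
  rcases hw with p | p
  · refine ((KG.1 p G.left).2.2 le_rfl).trans ?_
    have := ((Kl.2 (p.of_isLeft hl) (G.left - 1)).1.2 (by omega))
    rwa [sub_eq_add_neg, Pg.ofInt_add, Pg.ofInt_neg, add_neg_le_iff_le_add] at this
  · refine ((KG.2 p (G.left + 1)).2.2 (by omega)).trans ?_
    rw [Pg.ofInt_add]
    exact add_le_add_left ((Kl.1 (p.of_isLeft hl) G.left).1.2 (by omega)) _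

theorem exists_psi_le_add_one {r G : ScoringGame} (hw : G.WellTempered) (hG : GapBound 1 G)
    (hr : IsRight r G) : ∃ r, IsRight r G ∧ r.psi ≤ G.psi + ofInt 1 := by
  obtain ⟨r, hr, er⟩ := exists_right hr
  refine ⟨r, hr, ?_⟩
  have KG := psi_compare_int G hG
  have Kr := psi_compare_int r (hG.of_isRight hr)
  rcases hw with p | p
  · refine ((Kr.2 (p.of_isRight hr) (G.right + 1)).2.2 (by omega)).trans ?_
    rw [Pg.ofInt_add]
    exact add_le_add_left ((KG.1 p G.right).1.2 le_rfl) _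
  · refine ((Kr.1 (p.of_isRight hr) G.right).2.2 (by omega)).trans ?_
    have := ((KG.2 p (G.right - 1)).1.2 (by omega))
    rwa [sub_eq_add_neg, Pg.ofInt_add, Pg.ofInt_neg, add_neg_le_iff_le_add] at this

/-! ### Additivity of `ψ` -/

theorem WellTempered.of_isLeft {l G : ScoringGame} (hG : G.WellTempered) (h : IsLeft l G) :
    l.WellTempered :=
  hG.elim (fun p => .inr (p.of_isLeft h)) fun p => .inl (p.of_isLeft h)

theorem WellTempered.of_isRight {r G : ScoringGame} (hG : G.WellTempered) (h : IsRight r G) :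
    r.WellTempered :=
  hG.elim (fun p => .inr (p.of_isRight h)) fun p => .inl (p.of_isRight h)

/-- Unless one summand is an integer, the sums of scoring and of partizan games have corresponding
options, and induction applies. An integer summand has further moves only in the partizan sum; the
preceding lemmas show that these are dominated. -/
theorem psi_add {G H : ScoringGame} (wG : G.WellTempered) (wH : H.WellTempered)
    (hG : GapBound 1 G) (hH : GapBound 1 H) : (add G H).psi = G.psi + H.psi := by
  induction G using opt_induction generalizing H with
  | h G Gl Gr =>
    induction H using opt_induction with
    | h H Hl Hr =>
      replace Gl := fun l h => Gl l h (wG.of_isLeft h) wH (hG.of_isLeft h) hH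
      replace Gr := fun l h => Gr l h (wG.of_isRight h) wH (hG.of_isRight h) hH
      replace Hl := fun l h => Hl l h (wH.of_isLeft h) (hH.of_isLeft h)
      replace Hr := fun l h => Hr l h (wH.of_isRight h) (hH.of_isRight h)
      rcases int_or (add G H) with ⟨n, hn⟩ | ⟨⟨l₀, hl₀⟩, ⟨r₀, hr₀⟩⟩
      · obtain ⟨a, b, rfl, rfl, rfl⟩ := add_eq_int.1 hn
        exact Pg.ofInt_add a b
      refine le_antisymm ((Pg.mk_le_mk_iff (y := PartizanGame.add G.psiForm H.psiForm)).2
        ⟨fun x hx => ?_, fun x hx => ?_⟩)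
        ((Pg.mk_le_mk_iff (x := PartizanGame.add G.psiForm H.psiForm)).2
        ⟨fun x hx => ?_, fun x hx => ?_⟩)
      · obtain ⟨l, hl, rfl⟩ := exists_of_isLeft_psiForm' hl₀ hx
        rcases isLeft_add.1 hl with ⟨l, h, rfl⟩ | ⟨l, h, rfl⟩
        · show ¬ G.psi + H.psi ≤ (add l H).psi
          rw [Gl l h, add_le_add_iff_right]
          exact not_psi_le_of_isLeft h
        · show ¬ G.psi + H.psi ≤ (add G l).psi
          rw [Hl l h, add_le_add_iff_left]
          exact not_psi_le_of_isLeft h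
      · rcases PartizanGame.isRight_add.1 hx with ⟨x, h, rfl⟩ | ⟨x, h, rfl⟩
        · rcases exists_of_isRight_psiForm h with ⟨r, h', rfl⟩ | ⟨n, rfl, e⟩
          · show ¬ r.psi + H.psi ≤ (add G H).psi
            rw [← Gr r h']
            exact not_psi_le_of_isRight (isRight_add_left H h')
          -- Here G = n, and the partizan sum has the additional right option (n + 1) + ψ(H). It is
          -- at least n + ψ(r) for a suitable right option r of H, which is the value of a genuine
          -- right option of n + H.
          · obtain ⟨s, hs, -⟩ := isRight_int_add.1 hr₀
            obtain ⟨r, hr, k⟩ := exists_psi_le_add_one wH hH hs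
            refine fun j => not_psi_le_of_isRight (isRight_add_right (int n) hr) (le_trans ?_ j)
            rw [Hr r hr, Pg.mk_add, e, Pg.ofInt_add, add_assoc, add_comm (ofInt 1)]
            exact add_le_add_right k _
        · rcases exists_of_isRight_psiForm h with ⟨r, h', rfl⟩ | ⟨n, rfl, e⟩
          · show ¬ G.psi + r.psi ≤ (add G H).psi
            rw [← Hr r h']
            exact not_psi_le_of_isRight (isRight_add_right G h')
          · obtain ⟨s, hs, -⟩ := (isRight_add.1 hr₀).resolve_right fun ⟨_, h, _⟩ => h
            obtain ⟨r, hr, k⟩ := exists_psi_le_add_one wG hG hs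
            refine fun j => not_psi_le_of_isRight (isRight_add_left (int n) hr) (le_trans ?_ j)
            rw [Gr r hr, Pg.mk_add, e, add_comm n, Pg.ofInt_add, ← add_assoc]
            exact add_le_add_left k _
      · rcases PartizanGame.isLeft_add.1 hx with ⟨x, h, rfl⟩ | ⟨x, h, rfl⟩
        · rcases exists_of_isLeft_psiForm h with ⟨l, h', rfl⟩ | ⟨n, rfl, e⟩
          · show ¬ (add G H).psi ≤ l.psi + H.psi
            rw [← Gl l h']
            exact not_psi_le_of_isLeft (isLeft_add_left H h')
          · obtain ⟨s, hs, -⟩ := isLeft_int_add.1 hl₀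
            obtain ⟨l, hl, k⟩ := exists_psi_le_psi_add_one wH hH hs
            refine fun j => not_psi_le_of_isLeft (isLeft_add_right (int n) hl) (le_trans j ?_)
            rw [Hl l hl, Pg.mk_add, e, sub_eq_add_neg, Pg.ofInt_add, Pg.ofInt_neg, add_assoc]
            exact add_le_add_right (neg_add_le_iff_le_add.2 ((add_comm l.psi _) ▸ k)) _
        · rcases exists_of_isLeft_psiForm h with ⟨l, h', rfl⟩ | ⟨n, rfl, e⟩
          · show ¬ (add G H).psi ≤ G.psi + l.psi
            rw [← Hl l h']
            exact not_psi_le_of_isLeft (isLeft_add_right G h')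
          · obtain ⟨s, hs, -⟩ := (isLeft_add.1 hl₀).resolve_right fun ⟨_, h, _⟩ => h
            obtain ⟨l, hl, k⟩ := exists_psi_le_psi_add_one wG hG hs
            refine fun j => not_psi_le_of_isLeft (isLeft_add_left (int n) hl) (le_trans j ?_)
            rw [Gl l hl, Pg.mk_add, e, sub_eq_add_neg, add_comm n, Pg.ofInt_add, Pg.ofInt_neg,
              ← add_assoc]
            exact add_le_add_left (add_neg_le_iff_le_add.2 k) _
      · obtain ⟨r, hr, rfl⟩ := exists_of_isRight_psiForm' hr₀ hx
        rcases isRight_add.1 hr with ⟨r, h, rfl⟩ | ⟨r, h, rfl⟩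
        · show ¬ (add r H).psi ≤ G.psi + H.psi
          rw [Gr r h, add_le_add_iff_right]
          exact not_psi_le_of_isRight h
        · show ¬ (add G r).psi ≤ G.psi + H.psi
          rw [Hr r h, add_le_add_iff_left]
          exact not_psi_le_of_isRight h

theorem psi_int_add {G : ScoringGame} (wG : G.WellTempered) (hG : GapBound 1 G) (n : ℤ) :
    (add (int n) G).psi = ofInt n + G.psi :=
  psi_add (.inl rfl) wG (gapBound_int 1 n) hG

/-- The mirror strategy gives L(G - G) ≤ 0 ≤ R(G - G). The difference is even, so comparison with
the integer 0 shows that its value is 0. -/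
theorem psi_neg {G : ScoringGame} (wG : G.WellTempered) (hG : GapBound 1 G) :
    (neg G).psi = -G.psi := by
  obtain ⟨p, hp⟩ := wellTempered_iff.1 wG
  have hn := hG.neg hp
  refine eq_neg_of_add_eq_zero_right ?_
  rw [← psi_add wG wG.neg hG hn]
  have e : (add G (neg G)).IsEven := by
    rcases wG with p | p
    · exact p.add p.neg
    · exact p.add p.neg
  have K := (psi_compare_int _ (hG.add hp hp.neg hn)).1 e 0
  exact le_antisymm (K.2.2 (mirror G).2) (K.1.2 (mirror G).1)

/-- The criterion on the right refers only to outcomes and is the one that describes the order of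
I⁰; through it the two orders are identified. -/
theorem psi_le_psi_iff {G H : ScoringGame} (pG : G.IsEven) (pH : H.IsEven) (hG : GapBound 1 G)
    (hH : GapBound 1 H) : G.psi ≤ H.psi ↔ 0 ≤ (add H (neg G)).right := by
  have hn := hG.neg pG
  rw [← sub_nonneg, sub_eq_add_neg, ← psi_neg (.inl pG) hG,
    ← psi_add (.inl pH) (.inl pG.neg) hH hn]
  exact ((psi_compare_int _ (hH.add pH pG.neg hn)).1 (pH.add pG.neg) 0).1

/-! ### Heating and overheating -/

theorem psi_heat_one (G : ScoringGame) (hG : GapBound 1 G) :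
    (G.IsEven → (heat 1 G).psi = Pg.overheat G.psi) ∧
      (G.IsOdd → (heat 1 G).psi = Pg.star + Pg.overheat G.psi) := by
  induction G using opt_induction with
  | h G Gl Gr =>
    rcases int_or G with ⟨m, rfl⟩ | ⟨⟨l₀, hl₀⟩, ⟨r₀, hr₀⟩⟩
    · exact ⟨fun _ => (Pg.overheat_ofInt m).symm, fun h => (not_isOdd_int h).elim⟩
    have hl₁ : IsLeft _ (heat 1 G) := isLeft_heat.2 ⟨l₀, hl₀, rfl⟩
    have hr₁ : IsRight _ (heat 1 G) := isRight_heat.2 ⟨r₀, hr₀, rfl⟩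
    -- The heated option has gap bound 0, hence also 1, so ψ commutes with the translation.
    have eL : ∀ l, IsLeft l G → G.WellTempered →
        (add (int 1) (heat 1 l)).psi = ofInt 1 + (heat 1 l).psi := fun l hl w => by
      obtain ⟨p, hp⟩ := wellTempered_iff.1 (w.of_isLeft hl)
      exact psi_int_add (wellTempered_iff.2 ⟨p, hp.heat 1⟩)
        (((hG.of_isLeft hl).heat hp 1).mono (by norm_num)) 1
    have eR : ∀ r, IsRight r G → G.WellTempered →
        (add (int (-1)) (heat 1 r)).psi = -ofInt 1 + (heat 1 r).psi := fun r hr w => by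
      obtain ⟨p, hp⟩ := wellTempered_iff.1 (w.of_isRight hr)
      rw [← Pg.ofInt_neg]
      exact psi_int_add (wellTempered_iff.2 ⟨p, hp.heat 1⟩)
        (((hG.of_isRight hr).heat hp 1).mono (by norm_num)) (-1)
    set K := PartizanGame.add (PartizanGame.ofInt 1) PartizanGame.star
    have hK : Pg.mk K = ofInt 1 + Pg.star := rfl
    have oL : ∀ l : ScoringGame, Pg.mk ((K.overheat l.psiForm).add K) =
        Pg.overheat l.psi + (ofInt 1 + Pg.star) := fun l => by
      rw [Pg.mk_add, hK]; rfl
    have oR : ∀ r : ScoringGame, Pg.mk ((K.overheat r.psiForm).add K.neg) =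
        Pg.overheat r.psi - (ofInt 1 + Pg.star) := fun r => by
      rw [Pg.mk_add, Pg.mk_neg, hK, ← sub_eq_add_neg]; rfl
    constructor
    · intro p
      replace Gl : ∀ l, IsLeft l G → (add (int 1) (heat 1 l)).psi =
          Pg.mk ((K.overheat l.psiForm).add K) := fun l hl => by
        rw [eL l hl (.inl p), (Gl l hl (hG.of_isLeft hl)).2 (p.of_isLeft hl), oL]
        abel
      replace Gr : ∀ r, IsRight r G → (add (int (-1)) (heat 1 r)).psi =
          -- The inductive star combines with -1 to give -(1*), because * is its own negative.
          Pg.mk ((K.overheat r.psiForm).add K.neg) := fun r hr => by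
        rw [eR r hr (.inl p), (Gr r hr (hG.of_isRight hr)).2 (p.of_isRight hr), oR,
          ← sub_sub, sub_eq_add_neg _ Pg.star, Pg.neg_star]
        abel
      refine le_antisymm
        (Pg.mk_le_mk_of (y := K.overheat G.psiForm) (fun x hx => ?_) fun x hx => ?_)
        (Pg.mk_le_mk_of (x := K.overheat G.psiForm) (fun x hx => ?_) fun x hx => ?_)
      · obtain ⟨_, hx₁, rfl⟩ := exists_of_isLeft_psiForm' hl₁ hx
        obtain ⟨l, hl, rfl⟩ := isLeft_heat.1 hx₁
        exact ⟨_, PartizanGame.isLeft_overheat.2 ⟨_, isLeft_psiForm hl, rfl⟩, (Gl l hl).le⟩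
      · obtain ⟨_, hx₁, rfl⟩ := PartizanGame.isRight_overheat.1 hx
        obtain ⟨r, hr, rfl⟩ := exists_of_isRight_psiForm' hr₀ hx₁
        exact ⟨_, isRight_psiForm (isRight_heat.2 ⟨r, hr, rfl⟩), (Gr r hr).le⟩
      · obtain ⟨_, hx₁, rfl⟩ := PartizanGame.isLeft_overheat.1 hx
        obtain ⟨l, hl, rfl⟩ := exists_of_isLeft_psiForm' hl₀ hx₁
        exact ⟨_, isLeft_psiForm (isLeft_heat.2 ⟨l, hl, rfl⟩), (Gl l hl).ge⟩
      · obtain ⟨_, hx₁, rfl⟩ := exists_of_isRight_psiForm' hr₁ hx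
        obtain ⟨r, hr, rfl⟩ := isRight_heat.1 hx₁
        exact ⟨_, PartizanGame.isRight_overheat.2 ⟨_, isRight_psiForm hr, rfl⟩, (Gr r hr).ge⟩
    · intro p
      replace Gl : ∀ l, IsLeft l G → (add (int 1) (heat 1 l)).psi =
          ofInt 1 + Pg.overheat l.psi := fun l hl => by
        rw [eL l hl (.inr p), (Gl l hl (hG.of_isLeft hl)).1 (p.of_isLeft hl)]
      replace Gr : ∀ r, IsRight r G → (add (int (-1)) (heat 1 r)).psi =
          -ofInt 1 + Pg.overheat r.psi := fun r hr => by
        rw [eR r hr (.inr p), (Gr r hr (hG.of_isRight hr)).1 (p.of_isRight hr)]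
      -- A move in the second summand of * + ∫ψ(G) leaves the outer * in place; it cancels the star
      -- in 1* and only the integer 1 remains.
      have sL : ∀ l : ScoringGame, Pg.mk (PartizanGame.star.add ((K.overheat l.psiForm).add K)) =
          ofInt 1 + Pg.overheat l.psi := fun l => by
        rw [Pg.mk_add, oL, add_left_comm, add_left_comm (Pg.mk PartizanGame.star)]
        exact (congrArg _ (congrArg _ Pg.star_add_star)).trans
          ((congrArg _ (add_zero _)).trans (add_comm _ _))
      have sR : ∀ r : ScoringGame, Pg.mk
          (PartizanGame.star.add ((K.overheat r.psiForm).add K.neg)) =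
          -ofInt 1 + Pg.overheat r.psi := fun r => by
        rw [Pg.mk_add, oR, Pg.star]
        abel
      have zero_star : Pg.mk (PartizanGame.zero.add (K.overheat G.psiForm)) =
          Pg.overheat G.psi := _root_.zero_add (Pg.overheat G.psi)
      refine le_antisymm
        (Pg.mk_le_mk_of (y := PartizanGame.star.add (K.overheat G.psiForm))
          (fun x hx => ?_) fun x hx => ?_)
        (Pg.mk_le_mk_of (x := PartizanGame.star.add (K.overheat G.psiForm))
          (fun x hx => ?_) fun x hx => ?_)
      · obtain ⟨_, hx₁, rfl⟩ := exists_of_isLeft_psiForm' hl₁ hx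
        obtain ⟨l, hl, rfl⟩ := isLeft_heat.1 hx₁
        exact ⟨_, PartizanGame.isLeft_add.2 (.inr ⟨_, PartizanGame.isLeft_overheat.2
          ⟨_, isLeft_psiForm hl, rfl⟩, rfl⟩), ((Gl l hl).trans (sL l).symm).le⟩
      · rcases PartizanGame.isRight_add.1 hx with ⟨_, hx₁, rfl⟩ | ⟨_, hx₁, rfl⟩
        -- This option comes from moving * to 0 and has no counterpart in the heated game.
        -- Overheating ψ(r) ≤ ψ(G) + 1 gives -1 + ∫ψ(r) ≤ ∫ψ(G), so it is dominated.
        · rw [Pg.isRight_star.1 hx₁, zero_star]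
          obtain ⟨r, hr, k⟩ := exists_psi_le_add_one (.inr p) hG hr₀
          refine ⟨_, isRight_psiForm (isRight_heat.2 ⟨r, hr, rfl⟩), (Gr r hr).le.trans ?_⟩
          have := Pg.overheat_monotone k
          rw [map_add, Pg.overheat_ofInt, add_comm] at this
          exact neg_add_le_iff_le_add.2 this
        · obtain ⟨_, hx₂, rfl⟩ := PartizanGame.isRight_overheat.1 hx₁
          obtain ⟨r, hr, rfl⟩ := exists_of_isRight_psiForm' hr₀ hx₂
          exact ⟨_, isRight_psiForm (isRight_heat.2 ⟨r, hr, rfl⟩), ((Gr r hr).trans (sR r).symm).le⟩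
      · rcases PartizanGame.isLeft_add.1 hx with ⟨_, hx₁, rfl⟩ | ⟨_, hx₁, rfl⟩
        · rw [Pg.isLeft_star.1 hx₁, zero_star]
          obtain ⟨l, hl, k⟩ := exists_psi_le_psi_add_one (.inr p) hG hl₀
          refine ⟨_, isLeft_psiForm (isLeft_heat.2 ⟨l, hl, rfl⟩), le_trans ?_ (Gl l hl).ge⟩
          have := Pg.overheat_monotone k
          rwa [map_add, Pg.overheat_ofInt, add_comm] at this
        · obtain ⟨_, hx₂, rfl⟩ := PartizanGame.isLeft_overheat.1 hx₁
          obtain ⟨l, hl, rfl⟩ := exists_of_isLeft_psiForm' hl₀ hx₂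
          exact ⟨_, isLeft_psiForm (isLeft_heat.2 ⟨l, hl, rfl⟩), ((sL l).trans (Gl l hl).symm).le⟩
      · obtain ⟨_, hx₁, rfl⟩ := exists_of_isRight_psiForm' hr₁ hx
        obtain ⟨r, hr, rfl⟩ := isRight_heat.1 hx₁
        exact ⟨_, PartizanGame.isRight_add.2 (.inr ⟨_, PartizanGame.isRight_overheat.2
          ⟨_, isRight_psiForm hr, rfl⟩, rfl⟩), ((sR r).trans (Gr r hr).symm).le⟩

/-! ### Surjectivity of `ψ` -/

/-- For odd parity the form {m - 1 | m + 1} is used: its gap is exactly 2, and m is the only integer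
strictly between its outcomes. -/
theorem exists_psi_eq_ofInt (m : ℤ) (p : ZMod 2) :
    ∃ G : ScoringGame, G.HasParity p ∧ GapBound 1 G ∧ G.psi = ofInt m := by
  rcases (by revert p; decide : p = 0 ∨ p = 1) with rfl | rfl
  · exact ⟨int m, rfl, gapBound_int 1 m, rfl⟩
  · let G := node Unit Unit (fun _ => int (m - 1)) fun _ => int (m + 1)
    have hL : G.left = m - 1 := left_eq_of (l := int (m - 1)) ⟨(), rfl⟩
      (by rintro _ ⟨_, rfl⟩; exact le_rfl) ⟨_, ⟨(), rfl⟩, rfl⟩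
    have hR : G.right = m + 1 := right_eq_of (r := int (m + 1)) ⟨(), rfl⟩
      (by rintro _ ⟨_, rfl⟩; exact le_rfl) ⟨_, ⟨(), rfl⟩, rfl⟩
    have hp : G.IsOdd := ⟨fun _ => rfl, fun _ => rfl⟩
    have hG : GapBound 1 G := gapBound_of ⟨fun h => (h.not_isOdd hp).elim, fun _ => by omega⟩
      (by rintro _ ⟨_, rfl⟩; exact gapBound_int _ _) (by rintro _ ⟨_, rfl⟩; exact gapBound_int _ _)
    have K := (psi_compare_int G hG).2 hp m
    exact ⟨G, hp, hG, le_antisymm (K.2.2 (by omega)) (K.1.2 (by omega))⟩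

/-- Values compare with integers through finite outcomes, so large integers lie on the expected
sides. This will exclude empty families of options. -/
theorem exists_not_ofInt_le {G : ScoringGame} (wG : G.WellTempered) (hG : GapBound 1 G) :
    ∃ n : ℕ, ¬ ofInt n ≤ G.psi ∧ ¬ G.psi ≤ ofInt (-n) := by
  have K := psi_compare_int G hG
  refine ⟨G.right.natAbs + G.left.natAbs + 1, ?_⟩
  rcases wG with p | p
  · rw [((K.1 p _).1), (K.1 p _).2]
    omega
  · rw [((K.2 p _).1), (K.2 p _).2]
    omega

/-- If an integer fits between the options of x, the value is an integer and has already been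
realized. Otherwise the options are realized inductively in the other parity and assembled; a
violated gap bound, or an empty family of options, would produce a fitting integer. -/
theorem exists_psi_eq (x : PartizanGame) (p : ZMod 2) :
    ∃ G : ScoringGame, G.HasParity p ∧ GapBound 1 G ∧ G.psi = Pg.mk x := by
  induction x generalizing p with
  | mk α β L R ihL ihR =>
    by_cases hint : ∃ n : ℤ, (∀ i, ¬ ofInt n ≤ Pg.mk (L i)) ∧ ∀ j, ¬ Pg.mk (R j) ≤ ofInt n
    · obtain ⟨m, hm⟩ := Pg.exists_eq_ofInt (x := .mk α β L R) (by
        obtain ⟨n, h1, h2⟩ := hint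
        exact ⟨n, by rintro _ ⟨i, rfl⟩; exact h1 i, by rintro _ ⟨j, rfl⟩; exact h2 j⟩)
      rw [hm]
      exact exists_psi_eq_ofInt m p
    choose A pL hL eL using fun i => ihL i (p + 1)
    choose B pR hR eR using fun j => ihR j (p + 1)
    simp only [← eL, ← eR] at hint
    obtain ⟨a, ha⟩ := exists_forall_of_finite (P := fun i n => ¬ ofInt n ≤ (A i).psi)
      (fun i m n h k j => k ((Pg.ofInt_le_ofInt.2 (by omega)).trans j))
      fun i => (exists_not_ofInt_le (wellTempered_iff.2 ⟨_, pL i⟩) (hL i)).imp fun _ h => h.1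
    obtain ⟨b, hb⟩ := exists_forall_of_finite (P := fun j n => ¬ (B j).psi ≤ ofInt (-(n : ℕ)))
      (fun i m n h k j => k (j.trans (Pg.ofInt_le_ofInt.2 (by omega))))
      fun i => (exists_not_ofInt_le (wellTempered_iff.2 ⟨_, pR i⟩) (hR i)).imp fun _ h => h.2
    -- Without left options, a sufficiently negative integer would fit, since only the right options
    -- could exclude it. The case of no right options is symmetric.
    have : Nonempty α := by
      by_contra h
      exact hint ⟨_, fun i => (h ⟨i⟩).elim, hb⟩
    have : Nonempty β := by
      by_contra h
      exact hint ⟨_, ha, fun i => (h ⟨i⟩).elim⟩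
    let G := node α β A B
    have hp : G.HasParity p := ⟨pL, pR⟩
    have KL := fun i => psi_compare_int (A i) (hL i)
    have KR := fun i => psi_compare_int (B i) (hR i)
    have lL := fun i => right_le_left (G := G) ⟨i, rfl⟩
    have lR := fun i => right_le_left' (G := G) ⟨i, rfl⟩
    refine ⟨G, hp, gapBound_of ⟨fun q => ?_, fun q => ?_⟩ (by rintro _ ⟨i, rfl⟩; exact hL i)
      (by rintro _ ⟨i, rfl⟩; exact hR i), ?_⟩
    · by_contra hlt
      -- If L(G) < R(G), the integer L(G) fits: each odd left option has R ≤ L(G), and each odd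
      -- right option has L ≥ R(G) > L(G).
      refine hint ⟨G.left, fun i => ?_, fun j => ?_⟩
      · rw [((KL i).2 (q.of_isLeft ⟨i, rfl⟩) _).1]
        have := lL i
        omega
      · rw [((KR j).2 (q.of_isRight ⟨j, rfl⟩) _).2]
        have := lR j
        omega
    · by_contra hlt
      -- If R(G) > L(G) + 2, the integer L(G) + 1 fits: it exceeds R of every left option and is
      -- smaller than L of every right option.
      refine hint ⟨G.left + 1, fun i => ?_, fun j => ?_⟩
      · rw [((KL i).1 (q.of_isLeft ⟨i, rfl⟩) _).1]
        have := lL i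
        omega
      · rw [((KR j).1 (q.of_isRight ⟨j, rfl⟩) _).2]
        have := lR j
        omega
    · refine le_antisymm (Pg.mk_le_mk_of ?_ ?_) (Pg.mk_le_mk_of ?_ ?_)
      · rintro _ ⟨i, rfl⟩
        exact ⟨_, ⟨i, rfl⟩, (eL i).le⟩
      · rintro _ ⟨i, rfl⟩
        exact ⟨_, ⟨i, rfl⟩, (eR i).le⟩
      · rintro _ ⟨i, rfl⟩
        exact ⟨_, ⟨i, rfl⟩, (eL i).ge⟩
      · rintro _ ⟨i, rfl⟩
        exact ⟨_, ⟨i, rfl⟩, (eR i).ge⟩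

end ScoringGame

open ScoringGame

-- The order of I⁰ in terms of outcomes.

namespace evenInvertible

/-- Testing G ≲ H on X = -G gives R(H - G) ≥ R(G - G) ≥ 0. Conversely, R(H - G) ≥ 0 forces 0 ≲ H - G
by the lower bound on outcomes of sums, and adding G cancels -G in the group. -/
theorem mk_le_mk_iff {G H : ScoringGame} (hG : G.InI) (hH : H.InI) (pG : G.IsEven)
    (pH : H.IsEven) : mk G hG pG ≤ mk H hH pH ↔ 0 ≤ (H.add G.neg).right := by
  constructor
  · intro h
    have h' : ((G.add G.neg).left ≤ (H.add G.neg).left ∧ (G.add G.neg).right ≤ (H.add G.neg).right) :=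
      h ⟨G.neg, hG.neg.1⟩
    exact (mirror G).1.trans h'.2
  · intro h
    have h0 : GameClass.mk (.int 0) (.inl rfl) ≤
        GameClass.mk (H.add G.neg) (hH.1.add hG.neg.1) := by
      rintro ⟨X, hX⟩
      show ((ScoringGame.int 0).add X).left ≤ ((H.add G.neg).add X).left ∧
        ((ScoringGame.int 0).add X).right ≤ ((H.add G.neg).add X).right
      have lo := (outcome_lower (H.add G.neg) X
        (gap_zero_eq_zero_iff.1 (hH.add hG.neg).2)).1 (pH.add pG.neg)
      have c := add_comm_outcome₂ (H.add G.neg) X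
      have e := int_add_outcome 0 X
      omega
    have h1 := add_le_add_left h0 (GameClass.mk G hG.1)
    have e : GameClass.mk (H.add G.neg) (hH.1.add hG.neg.1) + GameClass.mk G hG.1 =
        GameClass.mk H hH.1 + (GameClass.mk (G.neg.add G) (hG.1.neg.add hG.1)) :=
      add_assoc (GameClass.mk H hH.1) (GameClass.mk G.neg hG.1.neg) (GameClass.mk G hG.1)
    rw [e, GameClass.mk_add_neg hG, add_zero] at h1
    exact (zero_add (GameClass.mk G hG.1)).ge.trans h1

end evenInvertible

-- Stages of the direct limit.

namespace ScoringGame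

/-- The image of an even-tempered game in the direct limit, computed at stage `n`. -/
def stage (n : ℕ) (G : ScoringGame) : Pg.Limit := Pg.Limit.of n (G.heat n).psi

theorem InF.of_le {m n : ℕ} {G : ScoringGame} (h : G.InF m) (hmn : m ≤ n) : G.InF n := by
  rw [inF_iff] at h ⊢
  exact ⟨h.1, h.2.mono (by exact_mod_cast hmn)⟩

theorem InI.exists_inF {G : ScoringGame} (hG : G.InI) : ∃ n : ℕ, G.InF (n + 1) := by
  obtain ⟨n, hn⟩ := hG.exists_gapBound
  exact ⟨n, (inF_iff.2 ⟨hG.1, hn⟩).of_le n.le_succ⟩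

theorem InF.gapBound_heat {n : ℕ} {G : ScoringGame} (h : G.InF (n + 1)) (p : G.IsEven) :
    GapBound 1 (G.heat n) := by
  have := (inF_iff.1 h).2.heat p n
  simpa using this

/-- Once G is heated by n it has gap bound 1, and so has every further heating; hence `psi_heat_one`
can be applied k times. -/
theorem psi_heat_add {n : ℕ} {G : ScoringGame} (h : G.InF (n + 1)) (p : G.IsEven) (k : ℕ) :
    (G.heat (n + k : ℕ)).psi = Pg.iter k (G.heat n).psi := by
  induction k with
  | zero => rfl
  | succ k ih =>
    have h' : G.InF (n + k + 1) := h.of_le (by omega)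
    have e : G.heat (n + (k + 1) : ℕ) = (G.heat (n + k : ℕ)).heat 1 := by
      rw [heat_heat]
      congr 1
      push_cast
      ring
    rw [e, (psi_heat_one _ (h'.gapBound_heat p)).1 (p.heat _), ih]
    rfl

theorem psi_heat_of_le {n m : ℕ} {G : ScoringGame} (h : G.InF (n + 1)) (p : G.IsEven)
    (hnm : n ≤ m) : (G.heat m).psi = Pg.transition n m hnm (G.heat n).psi := by
  obtain ⟨k, rfl⟩ := Nat.exists_eq_add_of_le hnm
  rw [psi_heat_add h p, Pg.transition, Nat.add_sub_cancel_left]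

theorem stage_eq {n m : ℕ} {G : ScoringGame} (h : G.InF (n + 1)) (p : G.IsEven) (hnm : n ≤ m) :
    stage m G = stage n G := by
  rw [stage, psi_heat_of_le h p hnm, Pg.Limit.of_transition, stage]

/-- Both orders are decided by the right outcome of H - G. This game is even, so heating does not
change that outcome. -/
theorem psi_heat_le_iff {n : ℕ} {G H : ScoringGame} (hG : G.InF (n + 1)) (hH : H.InF (n + 1))
    (pG : G.IsEven) (pH : H.IsEven) : (G.heat n).psi ≤ (H.heat n).psi ↔
      evenInvertible.mk G hG.1 pG ≤ evenInvertible.mk H hH.1 pH := by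
  rw [psi_le_psi_iff (pG.heat n) (pH.heat n) (hG.gapBound_heat pG) (hH.gapBound_heat pH),
    evenInvertible.mk_le_mk_iff, ← heat_neg, ← heat_add,
    ((heat_outcome n _).1 (pH.add pG.neg)).2]

/-- An inequality in the limit is witnessed at some finite stage and persists at a later stage N,
where both games satisfy the gap condition. There ψ reflects the order, so injectivity of the
transition maps is not required separately. -/
theorem stage_le_iff {n m : ℕ} {G H : ScoringGame} (hG : G.InF (n + 1)) (hH : H.InF (m + 1))
    (pG : G.IsEven) (pH : H.IsEven) : stage n G ≤ stage m H ↔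
      evenInvertible.mk G hG.1 pG ≤ evenInvertible.mk H hH.1 pH := by
  constructor
  · rintro ⟨k, a, b, ha, hb, hab⟩
    obtain ⟨k₁, h₁, h₁', e₁⟩ := Pg.Limit.of_eq_of ha
    obtain ⟨k₂, h₂, h₂', e₂⟩ := Pg.Limit.of_eq_of hb
    obtain ⟨N, hk₁, hk₂⟩ := exists_ge_ge k₁ k₂
    rw [← psi_heat_le_iff (n := N) (hG.of_le (by omega)) (hH.of_le (by omega)) pG pH,
      psi_heat_of_le hG pG (h₁.trans hk₁), psi_heat_of_le hH pH (h₂.trans hk₂)]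
    have e₁' := congrArg (Pg.transition k₁ N hk₁) e₁
    have e₂' := congrArg (Pg.transition k₂ N hk₂) e₂
    simp only [DirectedSystem.map_map' Pg.transition] at e₁' e₂'
    rw [e₁', e₂']
    exact Pg.transition_monotone _ _ _ hab
  · intro h
    obtain ⟨N, hn, hm⟩ := exists_ge_ge n m
    rw [← stage_eq hG pG hn, ← stage_eq hH pH hm]
    exact ⟨N, _, _, rfl, rfl, (psi_heat_le_iff (hG.of_le (by omega)) (hH.of_le (by omega))
      pG pH).2 h⟩

theorem stage_add {n : ℕ} {G H : ScoringGame} (hG : G.InF (n + 1)) (hH : H.InF (n + 1))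
    (pG : G.IsEven) (pH : H.IsEven) : stage n (G.add H) = stage n G + stage n H := by
  rw [stage, heat_add, psi_add (.inl (pG.heat n)) (.inl (pH.heat n)) (hG.gapBound_heat pG)
    (hH.gapBound_heat pH), map_add, stage, stage]

theorem InF.add {n : ℕ} {G H : ScoringGame} (hG : G.InF n) (hH : H.InF n) (pG : G.IsEven)
    (pH : H.IsEven) : (G.add H).InF n :=
  inF_iff.2 ⟨hG.1.1.add hH.1.1, (inF_iff.1 hG).2.add pG pH (inF_iff.1 hH).2⟩

/-- A preimage under ψ with gap bound 1 is cooled by n. Its gap bound rises to n + 1, and heating by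
n recovers the preimage. -/
theorem exists_stage_eq (n : ℕ) (x : Pg) :
    ∃ G : ScoringGame, G.InF (n + 1) ∧ G.IsEven ∧ stage n G = Pg.Limit.of n x := by
  obtain ⟨y, rfl⟩ := Pg.mk_surjective x
  obtain ⟨K, pK, hK, eK⟩ := exists_psi_eq y 0
  refine ⟨K.heat (-n), inF_iff.2 ⟨.inl (pK.heat _), ?_⟩, pK.heat _, ?_⟩
  · have := hK.heat pK (-n)
    rw [sub_neg_eq_add, add_comm] at this
    exact_mod_cast this
  · rw [stage, heat_heat, add_neg_cancel, heat_zero, eK]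

end ScoringGame

-- The isomorphism of I⁰ with the direct limit.

namespace evenInvertible

theorem exists_mk (x : evenInvertible) :
    ∃ (n : ℕ) (G : ScoringGame) (hF : G.InF (n + 1)) (hG : G.IsEven), x = mk G hF.1 hG := by
  obtain ⟨_, G, hI, hG, rfl⟩ := x
  obtain ⟨n, hn⟩ := hI.exists_inF
  exact ⟨n, G, hn, hG, rfl⟩

/-- The map of `I⁰` to the direct limit. -/
def toLimit (x : evenInvertible) : Pg.Limit :=
  stage (exists_mk x).choose (exists_mk x).choose_spec.choose

/-- The chosen representative and the given one have the same class, so their images at their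
respective stages bound each other by `stage_le_iff`. The value is thus independent of the choice.
-/
theorem toLimit_mk {n : ℕ} {G : ScoringGame} (hF : G.InF (n + 1)) (hG : G.IsEven) :
    toLimit (mk G hF.1 hG) = stage n G := by
  obtain ⟨hF', hG', e⟩ := (exists_mk (mk G hF.1 hG)).choose_spec.choose_spec
  exact le_antisymm ((stage_le_iff hF' hF hG' hG).2 e.ge) ((stage_le_iff hF hF' hG hG').2 e.le)

theorem toLimit_le_toLimit {x y : evenInvertible} : toLimit x ≤ toLimit y ↔ x ≤ y := by
  obtain ⟨n, G, hF, hG, rfl⟩ := exists_mk x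
  obtain ⟨m, H, hF', hH, rfl⟩ := exists_mk y
  rw [toLimit_mk hF, toLimit_mk hF', stage_le_iff hF hF' hG hH]

theorem toLimit_add (x y : evenInvertible) : toLimit (x + y) = toLimit x + toLimit y := by
  obtain ⟨n, G, hF, hG, rfl⟩ := exists_mk x
  obtain ⟨m, H, hF', hH, rfl⟩ := exists_mk y
  obtain ⟨N, hn, hm⟩ := exists_ge_ge n m
  replace hF : G.InF (N + 1) := hF.of_le (by omega)
  replace hF' : H.InF (N + 1) := hF'.of_le (by omega)
  rw [toLimit_mk hF, toLimit_mk hF', ← stage_add hF hF' hG hH]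
  exact toLimit_mk (hF.add hF' hG hH) (hG.add hH)

theorem toLimit_surjective : Function.Surjective toLimit := fun z => by
  obtain ⟨n, a, rfl⟩ := Pg.Limit.exists_of z
  obtain ⟨G, hF, hG, e⟩ := exists_stage_eq n a
  exact ⟨mk G hF.1 hG, (toLimit_mk hF hG).trans e⟩

/-- `I⁰` is isomorphic to the direct limit. -/
def limitIso : evenInvertible ≃+o Pg.Limit where
  __ := Equiv.ofBijective toLimit ⟨fun _ _ h =>
    le_antisymm (toLimit_le_toLimit.1 h.le) (toLimit_le_toLimit.1 h.ge), toLimit_surjective⟩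
  map_add' := toLimit_add
  map_le_map_iff' := toLimit_le_toLimit

end evenInvertible

end

theorem mainTheorem5 :
    (∀ G : ScoringGame, G.InJ →
      (G.IsEven → (G.heat 1).psi = Pg.overheat G.psi) ∧
      (G.IsOdd → (G.heat 1).psi = Pg.star + Pg.overheat G.psi)) ∧
    ∃ e : evenInvertible ≃+o Pg.Limit,
      ∀ (n : ℕ) (G : ScoringGame) (hF : G.InF (n + 1)) (hG : G.IsEven),
        e (evenInvertible.mk G hF.1 hG) = Pg.Limit.of n (G.heat n).psi :=
  ⟨fun G hG => ScoringGame.psi_heat_one G (ScoringGame.inJ_iff.1 hG).2,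
    evenInvertible.limitIso, fun _ _ hF hG => evenInvertible.toLimit_mk hF hG⟩
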